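/- Let $G$ be a linear graph: a directed graph with vertex set $\mathbb N=\{1,2,\dots\}$ whose edges are all pairs $(i,1)$ and $(i,i+1)$, $i\in\mathbb N$, together with some pairs $(i,j)$, $i<j-1$, only finitely many for each $i$. Assume that $G$ has bounded jumps: there is a constant $K$ such that $j-i<K$ for every edge $(i,j)$ with $i<j$. Let $\mathcal W$ be a function assigning to every edge a positive weight; the weight of a path is the product of the weights of its edges. For a subgraph $H\subset G$ and a vertex $v$, a simple $v$-cycle in $H$ is a path of length at least $1$ from $v$ to $v$ that does not go through $v$ in between. Let $q_{H,v}(k)$ be the sum of the weights of all simple $v$-cycles of length $k$ in $H$, put $\Phi_{H,v}(z)=\sum_{k\ge1}q_{H,v}(k)z^k$ for $z\ge0$, and let $R_v$ be the radius of convergence of $\Phi_{G,v}$. Assume that $(G,\mathcal W)$ is unstable positive, that is, $R_v>0$, $\Phi_{G,v}(R_v)=1$ and $\Phi_{G,v}'(R_v)<\infty$ for some vertex $v$. For a graph $H\subset G$ let $\Omega(H)$ be the set of the sequences $(\omega_i)_{i\in\mathbb Z}$ of vertices such that every $(\omega_i,\omega_{i+1})$ is an edge of $H$. An equilibrium measure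 of $(H,\mathcal W)$ is a shift invariant probability measure on $\Omega(H)$ that maximizes the functional $\mu\mapsto h(\mu)+\int\log\mathcal W(\omega_0,\omega_1)\,d\mu$ among all such measures, where $h$ is the entropy of the shift. Here, if $\log \mathcal W(\omega_0,\omega_1)$ is not $\mu$-integrable, the integral is understood as $\int[\log\mathcal W(\omega_0,\omega_1)+g(\omega_0)-g(\omega_1)]\,d\mu$ for any function $g$ on the vertex set that makes this integrand integrable (its value does not depend on $g$), and the functional is $-\infty$ if there is no such $g$. For $n\ge1$ let $G_n$ be the subgraph of $G$ generated by all simple $1$-cycles of length at most $n$, i.e. formed by the vertices and edges of these cycles. Then the sequence $(G_n)_{n\ge1}$ is an exhaustive sequence of finite subgraphs of $G$ (it increases, and its union is $G$) and it is regular relative to $\mathcal W$: $(G,\mathcal W)$ and all $(G_n,\mathcal W)$ have unique equilibrium measures $\mu$ and $\mu_n$, and, regarded as measures on $\Omega(G)$, the measures $\mu_n$ converge weakly to $\mu$ as $n\to\infty$. Moreover, with $\varphi=\Phi_{G,1}$, $R=R_1$, $\varphi_n=\Phi_{G_n,1}$, and $R_n>0$ the unique solution of $\varphi_n(R_n)=1$,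 one has $\varphi_n'(R_n)\to\varphi'(R)$ as $n\to\infty$. -/

import Mathlib

open MeasureTheory Filter Topology
open scoped NNReal ENNReal

namespace LoadedGraph

noncomputable section

/-! ### Simple cycles and their generating function

A directed graph is a `Digraph V`; a weight function is a map `W : V → V → ℝ≥0` of which only the
values on edges matter (they are required to be positive in the theorem). -/

variable {V : Type*}

/-- The simple `v`-cycles of length `n ≥ 1`, as vertex sequences `x 0, …, x n`: paths from `v` to
`v` that do not go through `v` in between. -/
def simpleCycles (G : Digraph V) (v : V) (n : ℕ) : Set (Fin (n + 1) → V) :=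
  {x | 1 ≤ n ∧ x 0 = v ∧ x (Fin.last n) = v ∧
    (∀ i : Fin n, G.Adj (x i.castSucc) (x i.succ)) ∧
    ∀ i : Fin (n + 1), i ≠ 0 → i ≠ Fin.last n → x i ≠ v}

/-- The weight of a path: the product of the weights of its edges. -/
def pathWeight (W : V → V → ℝ≥0) {n : ℕ} (x : Fin (n + 1) → V) : ℝ≥0 :=
  ∏ i : Fin n, W (x i.castSucc) (x i.succ)

/-- `q_v(n)`: the sum of the weights of all simple `v`-cycles of length `n`. -/
def cycleSum (G : Digraph V) (W : V → V → ℝ≥0) (v : V) (n : ℕ) : ℝ≥0∞ :=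
  ∑' x : simpleCycles G v n, (pathWeight W x.1 : ℝ≥0∞)

/-- The generating function `Φ(z) = ∑ q_v(n) z ^ n`, for `z ≥ 0`. -/
def genFun (G : Digraph V) (W : V → V → ℝ≥0) (v : V) (z : ℝ≥0∞) : ℝ≥0∞ :=
  ∑' n : ℕ, cycleSum G W v n * z ^ n

/-- The derivative `Φ'(z) = ∑ n q_v(n) z ^ (n - 1)`, for `z ≥ 0`. -/
def genFunDeriv (G : Digraph V) (W : V → V → ℝ≥0) (v : V) (z : ℝ≥0∞) : ℝ≥0∞ :=
  ∑' n : ℕ, ((n + 1 : ℕ) : ℝ≥0∞) * cycleSum G W v (n + 1) * z ^ n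

/-- The radius of convergence of the generating function. -/
def radius (G : Digraph V) (W : V → V → ℝ≥0) (v : V) : ℝ≥0∞ :=
  sSup {z : ℝ≥0∞ | genFun G W v z < ∞}

/-- Unstable positive loaded graphs: `Φ(R_v) = 1` and `Φ'(R_v) < ∞` for some vertex `v`. (The
first equation already forces `0 < R_v < ∞`.) -/
def IsUnstablePositive (G : Digraph V) (W : V → V → ℝ≥0) : Prop :=
  ∃ v : V, genFun G W v (radius G W v) = 1 ∧ genFunDeriv G W v (radius G W v) < ∞

/-- The subgraph generated by all simple `v`-cycles of length at most `n`. Its edges are the edges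
of these cycles, and its vertices are the endpoints of these edges. -/
def cycleSubgraph (G : Digraph V) (v : V) (n : ℕ) : Digraph V where
  Adj a b := ∃ l ≤ n, ∃ x ∈ simpleCycles G v l, ∃ i : Fin l, x i.castSucc = a ∧ x i.succ = b

/-- The graphs `H 0, H 1, …` form an exhaustive sequence of subgraphs of `G` (the vertices of
`H k` being the endpoints of its edges). -/
def IsExhaustive (G : Digraph V) (H : ℕ → Digraph V) : Prop :=
  (∀ k a b, (H k).Adj a b → G.Adj a b) ∧
  (∀ k a b, (H k).Adj a b → (H (k + 1)).Adj a b) ∧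
  (∀ a b, G.Adj a b → ∃ k, (H k).Adj a b) ∧
  (∀ a, ∃ k b, (H k).Adj a b ∨ (H k).Adj b a)

/-! ### Invariant measures and equilibrium measures

Measures on the path space `Ω(G)` are treated as measures on the space `ℤ → V` of all two-sided
sequences that are concentrated on the closed subset `Ω(G)`. In this way the measures of a graph
and of its subgraphs live on one space. -/

/-- The set `Ω(G)` of two-sided infinite paths. -/
def pathSpace (G : Digraph V) : Set (ℤ → V) :=
  {ω | ∀ i : ℤ, G.Adj (ω i) (ω (i + 1))}

/-- The left shift. -/
def shift (ω : ℤ → V) : ℤ → V := fun i => ω (i + 1)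

/-- The cylinder of all sequences that read `w` at the times `0, …, n - 1`. -/
def cylinder {n : ℕ} (w : Fin n → V) : Set (ℤ → V) :=
  {ω | ∀ i : Fin n, ω ((i : ℕ) : ℤ) = w i}

variable [MeasurableSpace V]

/-- The set `M(G)` of shift invariant probability measures on `Ω(G)`. -/
def invariantMeasures (G : Digraph V) : Set (ProbabilityMeasure (ℤ → V)) :=
  {μ | MeasurePreserving shift (μ : Measure (ℤ → V)) (μ : Measure (ℤ → V)) ∧
    ∀ᵐ ω ∂(μ : Measure (ℤ → V)), ω ∈ pathSpace G}

/-- The conditional entropy of the coordinate at time `n`, given the coordinates at the times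
`0, …, n - 1`: the sum, over the words `u = w a` of length `n + 1`, of
`μ[w a] * log (μ[w] / μ[w a])`. -/
def condEntropy (μ : Measure (ℤ → V)) (n : ℕ) : ℝ≥0∞ :=
  ∑' u : Fin (n + 1) → V, ENNReal.ofReal
    (μ.real (cylinder u) * Real.log (μ.real (cylinder (Fin.init u)) / μ.real (cylinder u)))

/-- The entropy of the shift with respect to the invariant measure `μ`: the limit (an infimum,
because the sequence is nonincreasing) of the conditional entropy of a coordinate given the `n`
preceding ones. On a path space with bounded out-degrees this is finite even if a single coordinate
has infinite entropy. -/
def entropy (μ : Measure (ℤ → V)) : ℝ≥0∞ :=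
  ⨅ n : ℕ, condEntropy μ n

/-- The functional `P(μ) = h(μ) + ∫ log W(ω₀, ω₁) dμ`. As `log W` need not be integrable, the
integral is taken after the addition of a coboundary `g(ω₀) - g(ω₁)` which makes the integrand
integrable. An integrable coboundary has integral zero with respect to an invariant measure, so
all admissible `g` give one value, and `g = 0` can be taken whenever `log W` is integrable. If no
`g` is admissible, the value is `-∞`. -/
def freeEnergy (W : V → V → ℝ≥0) (μ : Measure (ℤ → V)) : EReal :=
  ⨆ (g : V → ℝ)
    (_ : Integrable (fun ω : ℤ → V => Real.log (W (ω 0) (ω 1)) + g (ω 0) - g (ω 1)) μ),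
    (entropy μ : EReal) +
      ((∫ ω : ℤ → V, (Real.log (W (ω 0) (ω 1)) + g (ω 0) - g (ω 1)) ∂μ : ℝ) : EReal)

/-- An equilibrium measure of `(G, W)` is a shift invariant probability measure on `Ω(G)` at which
the functional `freeEnergy W` attains its maximum over all such measures. -/
def IsEquilibriumMeasure (G : Digraph V) (W : V → V → ℝ≥0)
    (μ : ProbabilityMeasure (ℤ → V)) : Prop :=
  μ ∈ invariantMeasures G ∧
    ∀ ν ∈ invariantMeasures G,
      freeEnergy W (ν : Measure (ℤ → V)) ≤ freeEnergy W (μ : Measure (ℤ → V))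

/-- The sequence `H` of finite subgraphs of `G` is regular relative to `W`: it is exhaustive, `G`
and the graphs `H k` have unique equilibrium measures, and the equilibrium measures of the `H k`
converge weakly to that of `G`. -/
def IsRegularSequence [TopologicalSpace V] [OpensMeasurableSpace (ℤ → V)]
    (G : Digraph V) (W : V → V → ℝ≥0) (H : ℕ → Digraph V) : Prop :=
  IsExhaustive G H ∧ (∀ k, {e : V × V | (H k).Adj e.1 e.2}.Finite) ∧
  (∃! μ, IsEquilibriumMeasure G W μ) ∧ (∀ k, ∃! μ, IsEquilibriumMeasure (H k) W μ) ∧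
  ∀ (μ : ProbabilityMeasure (ℤ → V)) (μs : ℕ → ProbabilityMeasure (ℤ → V)),
    IsEquilibriumMeasure G W μ → (∀ k, IsEquilibriumMeasure (H k) W (μs k)) →
    Tendsto μs atTop (𝓝 μ)

end

/-! ### Linear graphs -/

/-- All sets of positive integers are measurable. -/
instance instMeasurableSpacePNat : MeasurableSpace ℕ+ := ⊤

instance instDiscreteMeasurableSpacePNat : DiscreteMeasurableSpace ℕ+ := ⟨fun _ => trivial⟩

/-- Linear graphs on the positive integers: the edges are all `(i, 1)`, all `(i, i + 1)`, and some
forward jumps `(i, j)` with `i < j - 1`, finitely many for each `i`. -/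
structure IsLinear (G : Digraph ℕ+) : Prop where
  backward : ∀ i, G.Adj i 1
  step : ∀ i, G.Adj i (i + 1)
  edge : ∀ i j, G.Adj i j → j = 1 ∨ j = i + 1 ∨ i + 1 < j
  finite : ∀ i, {j | G.Adj i j ∧ i + 1 < j}.Finite

/-- The bounded jumps condition: `j - i < K` for all edges `(i, j)` with `i < j`. -/
def HasBoundedJumps (G : Digraph ℕ+) : Prop :=
  ∃ K : ℕ, ∀ i j : ℕ+, G.Adj i j → i < j → (j : ℕ) - (i : ℕ) < K

end LoadedGraph

namespace LoadedGraph

noncomputable section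


/-! ### First passage sums -/

section Passage

variable {V : Type*}

/-! Let `A` be the weight matrix. If the return series of a vertex `v` equals 1 at `z`, the first
passage sums h = `hitSum` and the sums l = `tabooSum` over paths from `v` without return are right
and left eigenvectors of `z A` for the eigenvalue 1. Cutting each simple cycle at all of its times
gives ∑ l h = z Φ'(z). If this is finite, p_ij = z A_ij h_j / h_i are the transitions of a Markov
chain with stationary law l h / (z Φ'(z)). As log W equals -log z + log p plus a coboundary of log
h, the free energy of an invariant measure is -log z plus its entropy minus its expectation of -log
p (and -∞ if that expectation is infinite). Gibbs' inequality bounds this by -log z, with equality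
for this chain alone (`exists_unique_equilibrium`). Bounded jumps bound the out-degrees, which makes
the expectation of -log p under the chain finite.

Unstable positivity is assumed at some vertex. In a linear graph paths ascend as long as they avoid
1, so every cycle passes through 1 and the property can be moved there (`unstable_positive_at_one`).

For the approximation, `G_n` contains all simple 1-cycles of `G` of length at most n. Its vertices
are at most Kn + 1, and its simple 1-cycles ascend, so their lengths are at most Kn + 1 too.
Comparing the return series through the linear term, which comes from the loop at 1, shows R ≤ R_n
and bounds R_n - R by a constant times the tail of Φ(R) beyond n (`mul_root_le`). As Φ'(R) is
finite, this tail is o(1/n), so (R_n / R)^(Kn + 2) tends to 1 (`tendsto_root_pow`). Passing from R_n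
to R thus costs a factor tending to 1 in all terms at once, while finite partial sums give the lower
bound. Hence φ_n'(R_n), h and l converge (`tendsto_of_roots`). Cylinder probabilities are explicit
in these quantities, and their convergence yields weak convergence. -/

open Classical in
/-- The weight matrix of a loaded graph. -/
def edgeWeight (G : Digraph V) (W : V → V → ℝ≥0) (i j : V) : ℝ≥0∞ :=
  if G.Adj i j then (W i j : ℝ≥0∞) else 0

open Classical in
/-- The total weight of the paths of length `n + 1` from `i` to `v` that do not go through `v` in
between. -/
def firstHit (A : V → V → ℝ≥0∞) (v : V) : ℕ → V → ℝ≥0∞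
  | 0, i => A i v
  | n + 1, i => ∑' j, if j = v then 0 else A i j * firstHit A v n j

open Classical in
/-- The total weight of the paths of length `n` from `v` to `j` that do not return to `v`. -/
def taboo (A : V → V → ℝ≥0∞) (v : V) : ℕ → V → ℝ≥0∞
  | 0, j => if j = v then 1 else 0
  | n + 1, j => if j = v then 0 else ∑' i, taboo A v n i * A i j

/-- The generating function of the first passage sums. -/
def hitSum (A : V → V → ℝ≥0∞) (v : V) (z : ℝ≥0∞) (i : V) : ℝ≥0∞ :=
  ∑' n : ℕ, firstHit A v n i * z ^ (n + 1)

/-- The generating function of the taboo sums. -/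
def tabooSum (A : V → V → ℝ≥0∞) (v : V) (z : ℝ≥0∞) (j : V) : ℝ≥0∞ :=
  ∑' n : ℕ, taboo A v n j * z ^ n

-- Splitting off the first vertex turns the sum over paths into the recursion. From here on simple
-- cycles can be handled through the matrix alone.
open Classical in
lemma tsum_path_eq_firstHit (A : V → V → ℝ≥0∞) (v : V) (n : ℕ) (i : V) :
    (∑' x : Fin (n + 2) → V,
      if x 0 = i ∧ x (Fin.last (n + 1)) = v ∧
          ∀ k : Fin (n + 2), k ≠ 0 → k ≠ Fin.last (n + 1) → x k ≠ v
        then ∏ k : Fin (n + 1), A (x k.castSucc) (x k.succ) else 0) = firstHit A v n i := by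
  induction n generalizing i with
  | zero =>
    rw [tsum_eq_single ![i, v]]
    · rw [if_pos]
      · simp [firstHit]
      · refine ⟨rfl, rfl, fun k h0 h1 => ?_⟩
        fin_cases k
        · exact absurd rfl h0
        · exact absurd rfl h1
    · intro x hx
      rw [if_neg]
      rintro ⟨h0, h1, -⟩
      apply hx
      funext k
      fin_cases k
      · exact h0
      · exact h1
  | succ n ih =>
    rw [firstHit]
    simp_rw [← ih]
    rw [← (Fin.consEquiv fun _ => V).tsum_eq, ENNReal.tsum_prod']
    rw [tsum_eq_single i]
    swap
    · intro a ha
      simp [Fin.consEquiv, ha]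
    -- The sum over `j` has one nonzero term, `j = y 0`; this redundant form allows the two sums to
    -- be interchanged.
    have key : ∀ y : Fin (n + 2) → V,
        (if (Fin.consEquiv fun _ => V) (i, y) 0 = i ∧
            (Fin.consEquiv fun _ => V) (i, y) (Fin.last (n + 1 + 1)) = v ∧
            ∀ k : Fin (n + 1 + 2), k ≠ 0 → k ≠ Fin.last (n + 1 + 1) →
              (Fin.consEquiv fun _ => V) (i, y) k ≠ v
          then ∏ k : Fin (n + 1 + 1), A ((Fin.consEquiv fun _ => V) (i, y) k.castSucc)
            ((Fin.consEquiv fun _ => V) (i, y) k.succ) else 0) =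
        ∑' j, if j = v then 0 else A i j *
          if y 0 = j ∧ y (Fin.last (n + 1)) = v ∧
            ∀ k : Fin (n + 2), k ≠ 0 → k ≠ Fin.last (n + 1) → y k ≠ v
          then ∏ k : Fin (n + 1), A (y k.castSucc) (y k.succ) else 0 := by
      intro y
      rw [tsum_eq_single (y 0)]
      swap
      · intro j hj
        split_ifs with h1 h2
        · rfl
        · exact absurd h2.1.symm hj
        · simp
      have hprod : ∏ k : Fin (n + 1 + 1), A ((Fin.consEquiv fun _ => V) (i, y) k.castSucc)
            ((Fin.consEquiv fun _ => V) (i, y) k.succ) =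
          A i (y 0) * ∏ k : Fin (n + 1), A (y k.castSucc) (y k.succ) := by
        rw [Fin.prod_univ_succ]
        congr 1
      rw [hprod]
      by_cases h : y 0 = v
      · rw [if_pos h, if_neg]
        rintro ⟨-, -, h3⟩
        exact h3 (Fin.succ 0) (Fin.succ_ne_zero _) (by simp [Fin.ext_iff]) h
      · rw [if_neg h]
        have hiff : ((Fin.consEquiv fun _ => V) (i, y) 0 = i ∧
            (Fin.consEquiv fun _ => V) (i, y) (Fin.last (n + 1 + 1)) = v ∧
            ∀ k : Fin (n + 1 + 2), k ≠ 0 → k ≠ Fin.last (n + 1 + 1) →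
              (Fin.consEquiv fun _ => V) (i, y) k ≠ v) ↔
            (y 0 = y 0 ∧ y (Fin.last (n + 1)) = v ∧
            ∀ k : Fin (n + 2), k ≠ 0 → k ≠ Fin.last (n + 1) → y k ≠ v) := by
          constructor
          · rintro ⟨-, h2, h3⟩
            refine ⟨rfl, h2, fun k hk hk' => h3 k.succ (Fin.succ_ne_zero _) ?_⟩
            rw [← Fin.succ_last]
            exact fun h => hk' (Fin.succ_injective _ h)
          · rintro ⟨-, h2, h3⟩
            refine ⟨rfl, h2, fun k hk hk' => ?_⟩
            obtain ⟨k, rfl⟩ := Fin.exists_succ_eq.mpr hk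
            change y k ≠ v
            by_cases hk0 : k = 0
            · rwa [hk0]
            · exact h3 k hk0 fun h => hk' (by rw [h, Fin.succ_last])
        simp only [hiff]
        split_ifs <;> simp
    rw [tsum_congr key, ENNReal.tsum_comm]
    congr with j
    split_ifs
    · simp
    · rw [ENNReal.tsum_mul_left]

lemma cycleSum_zero (G : Digraph V) (W : V → V → ℝ≥0) (v : V) : cycleSum G W v 0 = 0 := by
  rw [cycleSum, ENNReal.tsum_eq_zero]
  rintro ⟨x, hx⟩
  exact absurd hx.1 (by simp)

lemma cycleSum_succ (G : Digraph V) (W : V → V → ℝ≥0) (v : V) (n : ℕ) :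
    cycleSum G W v (n + 1) = firstHit (edgeWeight G W) v n v := by
  classical
  rw [← tsum_path_eq_firstHit, cycleSum,
    tsum_subtype (simpleCycles G v (n + 1)) fun x => (pathWeight W x : ℝ≥0∞)]
  congr with x
  rw [Set.indicator_apply]
  by_cases hx : x 0 = v ∧ x (Fin.last (n + 1)) = v ∧
          ∀ k : Fin (n + 2), k ≠ 0 → k ≠ Fin.last (n + 1) → x k ≠ v
  · rw [if_pos hx]
    by_cases hadj : ∀ i : Fin (n + 1), G.Adj (x i.castSucc) (x i.succ)
    · rw [if_pos ⟨by omega, hx.1, hx.2.1, hadj, hx.2.2⟩, pathWeight, ENNReal.ofNNReal_finsetProd]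
      refine Finset.prod_congr rfl fun k _ => ?_
      rw [edgeWeight, if_pos (hadj k)]
    · rw [if_neg fun h => hadj h.2.2.2.1]
      push Not at hadj
      obtain ⟨k, hk⟩ := hadj
      symm
      apply Finset.prod_eq_zero (Finset.mem_univ k)
      rw [edgeWeight, if_neg hk]
  · rw [if_neg hx, if_neg]
    exact fun h => hx ⟨h.2.1, h.2.2.1, h.2.2.2.2⟩

lemma genFun_eq (G : Digraph V) (W : V → V → ℝ≥0) (v : V) (z : ℝ≥0∞) :
    genFun G W v z = hitSum (edgeWeight G W) v z v := by
  rw [genFun, hitSum, tsum_eq_zero_add' ENNReal.summable]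
  simp [cycleSum_zero, cycleSum_succ]

lemma genFunDeriv_eq (G : Digraph V) (W : V → V → ℝ≥0) (v : V) (z : ℝ≥0∞) :
    genFunDeriv G W v z =
      ∑' n : ℕ, ((n + 1 : ℕ) : ℝ≥0∞) * firstHit (edgeWeight G W) v n v * z ^ n := by
  simp_rw [genFunDeriv, cycleSum_succ]

lemma tsum_nat_nat_antidiagonal (f : ℕ → ℕ → ℝ≥0∞) :
    (∑' (n : ℕ) (m : ℕ), f n m) = ∑' k : ℕ, ∑ p ∈ Finset.HasAntidiagonal.antidiagonal k, f p.1 p.2 := by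
  rw [← ENNReal.tsum_prod (f := f),
    ← Finset.HasAntidiagonal.sigmaAntidiagonalEquivProd.tsum_eq, ENNReal.tsum_sigma']
  congr with k
  rw [tsum_fintype]
  exact Finset.sum_coe_sort (Finset.HasAntidiagonal.antidiagonal k) fun p => f p.1 p.2

/-- The `k + 1` ways to split `k` are the source of the derivative of the generating function. -/
lemma tsum_nat_nat_add (f : ℕ → ℝ≥0∞) :
    (∑' (n : ℕ) (m : ℕ), f (n + m)) = ∑' k : ℕ, ((k + 1 : ℕ) : ℝ≥0∞) * f k := by
  rw [tsum_nat_nat_antidiagonal fun n m => f (n + m)]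
  congr with k
  rw [Finset.sum_congr rfl (g := fun _ => f k)]
  · simp
  · intro p hp
    rw [Finset.HasAntidiagonal.mem_antidiagonal] at hp
    rw [hp]

variable (A : V → V → ℝ≥0∞) (v : V) (z : ℝ≥0∞)

/-- A simple cycle is cut at time `n`; the two recursions move the cut by one step without changing
the sum. -/
lemma tsum_taboo_mul_firstHit (n m : ℕ) :
    ∑' j, taboo A v n j * firstHit A v m j = firstHit A v (n + m) v := by
  classical
  induction n generalizing m with
  | zero =>
    rw [tsum_eq_single v]
    · simp [taboo]
    · intro j hj
      simp [taboo, hj]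
  | succ n ih =>
    rw [show n + 1 + m = n + (m + 1) by ring, ← ih (m + 1)]
    simp_rw [firstHit, ← ENNReal.tsum_mul_left]
    rw [ENNReal.tsum_comm]
    congr with j
    rw [taboo]
    split_ifs
    · simp
    · rw [← ENNReal.tsum_mul_right]
      simp_rw [mul_assoc]

/-- A simple cycle of length `k + 1` can be cut at `k + 1` times. The left side normalizes the
stationary law, so finiteness of the derivative is positive recurrence. -/
lemma tsum_tabooSum_mul_hitSum :
    ∑' j, tabooSum A v z j * hitSum A v z j =
      z * ∑' n : ℕ, ((n + 1 : ℕ) : ℝ≥0∞) * firstHit A v n v * z ^ n := by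
  simp_rw [tabooSum, hitSum, ← ENNReal.tsum_mul_right, ← ENNReal.tsum_mul_left]
  rw [ENNReal.tsum_comm]
  have h : ∀ n : ℕ, ∑' (j : V) (m : ℕ),
      taboo A v n j * z ^ n * (firstHit A v m j * z ^ (m + 1)) =
      ∑' m : ℕ, firstHit A v (n + m) v * z ^ (n + m + 1) := by
    intro n
    rw [ENNReal.tsum_comm]
    congr with m
    rw [← tsum_taboo_mul_firstHit, ← ENNReal.tsum_mul_right]
    congr with j
    ring
  simp_rw [h]
  rw [tsum_nat_nat_add fun k => firstHit A v k v * z ^ (k + 1)]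
  congr with k
  ring

open Classical in
lemma hitSum_eq (i : V) :
    hitSum A v z i = z * A i v + ∑' j, if j = v then 0 else z * A i j * hitSum A v z j := by
  rw [hitSum, tsum_eq_zero_add' ENNReal.summable]
  congr 1
  · simp [firstHit, mul_comm]
  · simp_rw [firstHit, ← ENNReal.tsum_mul_right]
    rw [ENNReal.tsum_comm]
    congr with j
    split_ifs
    · simp
    · rw [hitSum, ← ENNReal.tsum_mul_left]
      congr with n
      ring

/-- The first passage recursion treats the target `v` as a boundary point with value 1; the
hypothesis makes this the actual value. -/
lemma hitSum_eq_of_eq_one (h : hitSum A v z v = 1) (i : V) :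
    hitSum A v z i = ∑' j, z * A i j * hitSum A v z j := by
  classical
  rw [hitSum_eq, ENNReal.tsum_eq_add_tsum_ite (f := fun j => z * A i j * hitSum A v z j) v, h,
    mul_one]

lemma tabooSum_self : tabooSum A v z v = 1 := by
  rw [tabooSum, tsum_eq_single 0]
  · simp [taboo]
  · rintro (_ | n) hn
    · exact absurd rfl hn
    · simp [taboo]

/-- Away from `v` this is the recursion. At `v`, the right side cuts the simple cycles before their
last step and equals the return series, which is 1. -/
lemma tabooSum_eq_of_eq_one (h : hitSum A v z v = 1) (j : V) :
    tabooSum A v z j = ∑' i, tabooSum A v z i * (z * A i j) := by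
  classical
  have key : ∑' i, tabooSum A v z i * (z * A i j) =
      ∑' n, (∑' i, taboo A v n i * A i j) * z ^ (n + 1) := by
    simp_rw [tabooSum, ← ENNReal.tsum_mul_right]
    rw [ENNReal.tsum_comm]
    congr with n
    congr with i
    ring
  rw [key]
  by_cases hj : j = v
  · subst hj
    rw [tabooSum_self, ← h, hitSum]
    congr with n
    congr 1
    exact (tsum_taboo_mul_firstHit A j n 0).symm
  · rw [tabooSum, tsum_eq_zero_add' ENNReal.summable]
    simp [taboo, hj]

end Passage


/-! ### Measures on two-sided sequences -/

section Sequences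

variable {V : Type*}

/-- The cylinder of all sequences that agree with `w` at the times `a, …, b`. -/
def windowSet (a b : ℤ) (w : ℤ → V) : Set (ℤ → V) :=
  {ω | ∀ k, a ≤ k → k ≤ b → ω k = w k}

/-- The symmetric cylinders. -/
def symmWindows (V : Type*) : Set (Set (ℤ → V)) :=
  {s | ∃ (m : ℕ) (w : ℤ → V), s = windowSet (-(m + 1)) (m + 1) w}

/-- The shift by `i` places. -/
def shiftBy (i : ℤ) (ω : ℤ → V) : ℤ → V := fun k => ω (k + i)

/-- Two windows with a common point `x` intersect in the window around `x` of the larger size. -/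
lemma isPiSystem_symmWindows : IsPiSystem (symmWindows V) := by
  rintro _ ⟨m, w, rfl⟩ _ ⟨m', w', rfl⟩ ⟨x, hx, hx'⟩
  refine ⟨max m m', x, ?_⟩
  ext ω
  constructor
  · rintro ⟨h, h'⟩ k hk hk'
    rcases le_total m m' with hm | hm
    · rw [h' k (by grind) (by grind), hx' k (by grind) (by grind)]
    · rw [h k (by grind) (by grind), hx k (by grind) (by grind)]
  · intro h
    constructor
    · intro k hk hk'
      rw [h k (by grind) (by grind), hx k hk hk']
    · intro k hk hk'
      rw [h k (by grind) (by grind), hx' k hk hk']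

/-- The orbit of a sequence of self-maps of `V`, encoded in `x`, that starts at `x none`. The
maps used depend on the direction of time `b`. -/
def orbitOf (b : Bool) (x : Option (Bool × ℕ × V) → V) : ℕ → V
  | 0 => x none
  | n + 1 => x (some (b, n, orbitOf b x n))

/-- The two-sided sequence made of the orbits in the two directions of time. -/
def twoSidedOrbit (x : Option (Bool × ℕ × V) → V) (k : ℤ) : V :=
  orbitOf (decide (0 ≤ k)) x k.natAbs

/-- Following a prescribed path tests only the coordinates met along that path, so the event is a
finite-dimensional rectangle. -/
lemma orbitOf_eq_iff (b : Bool) (x : Option (Bool × ℕ × V) → V) (u : ℕ → V) (n : ℕ) :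
    (∀ k ≤ n, orbitOf b x k = u k) ↔
      x none = u 0 ∧ ∀ k < n, x (some (b, k, u k)) = u (k + 1) := by
  constructor
  · intro h
    refine ⟨h 0 (Nat.zero_le _), fun k hk => ?_⟩
    have := h (k + 1) hk
    rwa [orbitOf, h k hk.le] at this
  · rintro ⟨h0, h1⟩ k
    induction k with
    | zero => exact fun _ => h0
    | succ k ih =>
      intro hk
      rw [orbitOf, ih (by omega), h1 k (by omega)]

lemma preimage_twoSidedOrbit_windowSet (m n : ℕ) (w : ℤ → V) :
    twoSidedOrbit ⁻¹' windowSet (-m) n w =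
      {x | x none = w 0 ∧ (∀ k < n, x (some (true, k, w k)) = w (k + 1)) ∧
        ∀ k < m, x (some (false, k, w (-k))) = w (-(k + 1))} := by
  ext x
  have h1 := orbitOf_eq_iff true x (fun k => w k) n
  have h2 := orbitOf_eq_iff false x (fun k => w (-k)) m
  simp only [Nat.cast_zero, neg_zero, Nat.cast_add, Nat.cast_one] at h1 h2
  have h3 : x ∈ twoSidedOrbit ⁻¹' windowSet (-m) n w ↔
      (∀ k ≤ n, orbitOf true x k = w k) ∧ ∀ k ≤ m, orbitOf false x k = w (-k) := by
    constructor
    · intro h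
      refine ⟨fun k hk => ?_, fun k hk => ?_⟩
      · have := h k (by omega) (by omega)
        simpa [twoSidedOrbit] using this
      · rcases Nat.eq_zero_or_pos k with rfl | hk0
        · have := h 0 (by omega) (by omega)
          simpa [twoSidedOrbit, orbitOf] using this
        · have := h (-k) (by omega) (by omega)
          have hd : decide ((0 : ℤ) ≤ -(k : ℤ)) = false := by simp; omega
          rwa [twoSidedOrbit, hd, Int.natAbs_neg, Int.natAbs_natCast] at this
    · rintro ⟨h, h'⟩ k hk hk'
      by_cases hk0 : 0 ≤ k
      · have := h k.natAbs (by omega)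
        rw [twoSidedOrbit, decide_eq_true hk0, this]
        congr 1
        omega
      · have := h' k.natAbs (by omega)
        rw [twoSidedOrbit, decide_eq_false hk0, this]
        congr 1
        omega
  rw [h3, h1, h2]
  simp only [Set.mem_ofPred_eq]
  tauto

variable [MeasurableSpace V]

lemma measurable_shiftBy (i : ℤ) : Measurable (shiftBy i : (ℤ → V) → ℤ → V) :=
  measurable_pi_lambda _ fun _ => measurable_pi_apply _

variable [DiscreteMeasurableSpace V]

lemma measurableSet_windowSet (a b : ℤ) (w : ℤ → V) : MeasurableSet (windowSet a b w) := by
  have : windowSet a b w = ⋂ k ∈ Set.Icc a b, (fun ω : ℤ → V => ω k) ⁻¹' {w k} := by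
    ext ω
    simp [windowSet]
  rw [this]
  exact MeasurableSet.biInter (Set.to_countable _) fun k _ =>
    measurable_pi_apply k (MeasurableSet.of_discrete)

lemma measurableSet_cylinder {n : ℕ} (w : Fin n → V) : MeasurableSet (cylinder w) := by
  have : cylinder w = ⋂ k : Fin n, (fun ω : ℤ → V => ω (k : ℕ)) ⁻¹' {w k} := by
    ext ω
    simp [cylinder]
  rw [this]
  exact MeasurableSet.iInter fun k =>
    measurable_pi_apply _ (MeasurableSet.of_discrete)

/-- Restriction to a finite time interval has countably many values, and its fibres are windows. -/
lemma generateFrom_symmWindows [Countable V] :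
    (MeasurableSpace.pi : MeasurableSpace (ℤ → V)) =
      MeasurableSpace.generateFrom (symmWindows V) := by
  apply le_antisymm
  · refine iSup_le fun k => ?_
    rw [← measurable_iff_comap_le]
    rcases isEmpty_or_nonempty V with hV | ⟨⟨a⟩⟩
    · intro s _
      rw [Set.eq_empty_of_isEmpty s]
      simp
    have hmem : k ∈ Finset.Icc (-((k.natAbs : ℤ) + 1)) (k.natAbs + 1) := by
      rw [Finset.mem_Icc]
      omega
    have hr : @Measurable _ _ (MeasurableSpace.generateFrom (symmWindows V)) ⊤
        fun (ω : ℤ → V) (j : Finset.Icc (-((k.natAbs : ℤ) + 1)) (k.natAbs + 1)) => ω j := by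
      refine @measurable_to_countable' _ _ ⊤ _ (MeasurableSpace.generateFrom (symmWindows V)) _ ?_
      intro u
      apply MeasurableSpace.measurableSet_generateFrom
      classical
      refine ⟨k.natAbs, fun j => if h : j ∈ Finset.Icc (-((k.natAbs : ℤ) + 1)) (k.natAbs + 1)
        then u ⟨j, h⟩ else a, ?_⟩
      ext ω
      constructor
      · intro h j hj hj'
        have hj2 : j ∈ Finset.Icc (-((k.natAbs : ℤ) + 1)) (k.natAbs + 1) :=
          Finset.mem_Icc.mpr ⟨hj, hj'⟩
        simp only [dif_pos hj2]
        exact congrFun h ⟨j, hj2⟩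
      · intro h
        funext ⟨j, hj⟩
        have := h j (Finset.mem_Icc.mp hj).1 (Finset.mem_Icc.mp hj).2
        simpa only [dif_pos hj] using this
    exact (@measurable_from_top _ _ _ (fun f => f ⟨k, hmem⟩)).comp hr
  · apply MeasurableSpace.generateFrom_le
    rintro _ ⟨m, w, rfl⟩
    exact measurableSet_windowSet _ _ _

/-- The shift as a measurable equivalence. -/
def shiftEquiv (V : Type*) [MeasurableSpace V] [DiscreteMeasurableSpace V] :
    (ℤ → V) ≃ᵐ (ℤ → V) where
  toFun := shift
  invFun := shiftBy (-1)
  left_inv ω := by funext k; simp [shift, shiftBy]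
  right_inv ω := by funext k; simp [shift, shiftBy]
  measurable_toFun := measurable_shiftBy 1
  measurable_invFun := measurable_shiftBy (-1)

lemma measurePreserving_shiftBy {μ : Measure (ℤ → V)} (h : MeasurePreserving shift μ μ) (i : ℤ) :
    MeasurePreserving (shiftBy i) μ μ := by
  have h' : MeasurePreserving (shiftBy (-1)) μ μ :=
    MeasurePreserving.symm (shiftEquiv V) h
  induction i with
  | zero =>
    convert! MeasurePreserving.id μ using 1
    funext ω k
    simp [shiftBy]
  | succ n ih =>
    convert! ih.comp h using 1
    funext ω k
    simp only [shiftBy, Function.comp_apply, shift, add_assoc]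
  | pred n ih =>
    convert! ih.comp h' using 1
    funext ω k
    simp only [shiftBy, Function.comp_apply]
    congr 1
    ring

lemma measure_windowSet_eq_cylinder {μ : Measure (ℤ → V)} (h : MeasurePreserving shift μ μ)
    (a : ℤ) (n : ℕ) (w : ℤ → V) :
    μ (windowSet a (a + n) w) = μ (cylinder fun k : Fin (n + 1) => w (a + (k : ℕ))) := by
  rw [← (measurePreserving_shiftBy h a).measure_preimage
    (measurableSet_cylinder _).nullMeasurableSet]
  congr 1
  ext ω
  constructor
  · intro hω k
    have := hω (a + (k : ℕ)) (by omega) (by omega)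
    simpa [shiftBy, add_comm] using this
  · intro hω k hk hk'
    have := hω ⟨(k - a).toNat, by omega⟩
    have e : (((k - a).toNat : ℕ) : ℤ) = k - a := Int.toNat_of_nonneg (by omega)
    simpa [shiftBy, e] using this

lemma ext_of_symmWindows [Countable V] {μ ν : Measure (ℤ → V)} [IsProbabilityMeasure μ]
    [IsProbabilityMeasure ν] (h : ∀ s ∈ symmWindows V, μ s = ν s) : μ = ν :=
  ext_of_generate_finite _ generateFrom_symmWindows isPiSystem_symmWindows h (by simp)

lemma ext_of_cylinder [Countable V] {μ ν : Measure (ℤ → V)} [IsProbabilityMeasure μ]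
    [IsProbabilityMeasure ν] (hμ : MeasurePreserving shift μ μ) (hν : MeasurePreserving shift ν ν)
    (h : ∀ (n : ℕ) (w : Fin (n + 1) → V), μ (cylinder w) = ν (cylinder w)) : μ = ν := by
  apply ext_of_symmWindows
  rintro _ ⟨m, w, rfl⟩
  have e : ((m : ℤ) + 1) = -(m + 1) + ((2 * m + 2 : ℕ) : ℤ) := by push_cast; ring
  conv_lhs => rw [e]
  conv_rhs => rw [e]
  rw [show (-(-((m : ℤ) + 1) + ((2 * m + 2 : ℕ) : ℤ))) = -(m + 1) by push_cast; ring,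
    measure_windowSet_eq_cylinder hμ, measure_windowSet_eq_cylinder hν, h]

/-- The windows form a π-system that contains a neighbourhood base at each point, because `V` is
discrete, so convergence on them implies weak convergence. Invariance moves them to cylinders
starting at time 0. -/
lemma tendsto_of_tendsto_cylinder [Countable V] [TopologicalSpace V] [DiscreteTopology V]
    [OpensMeasurableSpace (ℤ → V)]
    {μs : ℕ → ProbabilityMeasure (ℤ → V)} {μ : ProbabilityMeasure (ℤ → V)}
    (hμ : MeasurePreserving shift (μ : Measure (ℤ → V)) μ)
    (hμs : ∀ k, MeasurePreserving shift (μs k : Measure (ℤ → V)) (μs k))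
    (h : ∀ (n : ℕ) (w : Fin (n + 1) → V),
      Tendsto (fun k => (μs k : Measure (ℤ → V)) (cylinder w)) atTop
        (𝓝 ((μ : Measure (ℤ → V)) (cylinder w)))) :
    Tendsto μs atTop (𝓝 μ) := by
  apply isPiSystem_symmWindows.tendsto_probabilityMeasure_of_tendsto_of_mem
  · rintro _ ⟨m, w, rfl⟩
    exact measurableSet_windowSet _ _ _
  · intro u hu x hx
    obtain ⟨I, t, ht, hsub⟩ := isOpen_pi_iff.mp hu x hx
    refine ⟨_, ⟨I.sup Int.natAbs, x, rfl⟩, ?_, ?_⟩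
    · apply IsOpen.mem_nhds
      · have : windowSet (-(((I.sup Int.natAbs : ℕ) : ℤ) + 1)) ((I.sup Int.natAbs : ℕ) + 1) x =
            Set.pi (Set.Icc (-(((I.sup Int.natAbs : ℕ) : ℤ) + 1)) ((I.sup Int.natAbs : ℕ) + 1))
              fun k => {x k} := by
          ext ω
          simp [windowSet, Set.mem_pi]
        rw [this]
        exact isOpen_set_pi (Set.finite_Icc _ _) fun _ _ => isOpen_discrete _
      · exact fun k _ _ => rfl
    · intro ω hω
      apply hsub
      intro k hk
      have hle : k.natAbs ≤ I.sup Int.natAbs := Finset.le_sup (f := Int.natAbs) hk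
      rw [hω k (by omega) (by omega)]
      exact (ht k hk).2
  · rintro _ ⟨m, w, rfl⟩
    have e : windowSet (-((m : ℤ) + 1)) (m + 1) w =
        windowSet (-((m : ℤ) + 1)) (-((m : ℤ) + 1) + ((2 * m + 2 : ℕ) : ℤ)) w := by
      congr 1
      push_cast
      ring
    rw [e]
    have h1 := h _ fun k : Fin (2 * m + 2 + 1) => w (-((m : ℤ) + 1) + (k : ℕ))
    rw [← measure_windowSet_eq_cylinder hμ] at h1
    simp_rw [← measure_windowSet_eq_cylinder (hμs _)] at h1
    rw [← ENNReal.tendsto_coe]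
    simpa using h1

/-! ### Two-sided Markov measures -/

lemma measurable_orbitOf [Countable V] (b : Bool) (n : ℕ) :
    Measurable fun x : Option (Bool × ℕ × V) → V => orbitOf b x n := by
  induction n with
  | zero => exact measurable_pi_apply _
  | succ n ih =>
    have h : Measurable fun q : (Option (Bool × ℕ × V) → V) × V => q.1 (some (b, n, q.2)) :=
      measurable_from_prod_countable_left fun i => measurable_pi_apply (some (b, n, i))
    exact h.comp (measurable_id.prodMk ih)

lemma measurable_twoSidedOrbit [Countable V] :
    Measurable (twoSidedOrbit : (Option (Bool × ℕ × V) → V) → ℤ → V) :=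
  measurable_pi_lambda _ fun _ => measurable_orbitOf _ _

/-- Direction and time are part of the index, so the coordinates involved are distinct, hence
independent, even if the path revisits a vertex. -/
lemma infinitePi_orbit_event [Countable V] (ν : Option (Bool × ℕ × V) → Measure V)
    [∀ i, IsProbabilityMeasure (ν i)] (m n : ℕ) (w : ℤ → V) :
    Measure.infinitePi ν {x | x none = w 0 ∧ (∀ k < n, x (some (true, k, w k)) = w (k + 1)) ∧
        ∀ k < m, x (some (false, k, w (-k))) = w (-(k + 1))} =
      ν none {w 0} * ((∏ k ∈ Finset.range n, ν (some (true, k, w k)) {w (k + 1)}) *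
        ∏ k ∈ Finset.range m, ν (some (false, k, w (-k))) {w (-(k + 1))}) := by
  classical
  let e : Bool → ℕ ↪ Bool × ℕ × V := fun b =>
    ⟨fun k => (b, k, w (if b then k else -k)), fun k l h => by simpa using (Prod.ext_iff.mp
      (Prod.ext_iff.mp h).2).1⟩
  let s : Finset (Bool × ℕ × V) :=
    (Finset.range n).map (e true) ∪ (Finset.range m).map (e false)
  have hdisj : Disjoint ((Finset.range n).map (e true)) ((Finset.range m).map (e false)) := by
    rw [Finset.disjoint_left]
    intro x hx hx'
    obtain ⟨k, -, rfl⟩ := Finset.mem_map.mp hx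
    obtain ⟨l, -, hl⟩ := Finset.mem_map.mp hx'
    exact absurd (Prod.ext_iff.mp hl).1 (by simp [e])
  let t : Option (Bool × ℕ × V) → Set V := fun o =>
    match o with
    | none => {w 0}
    | some (b, k, _) => {w (if b then (k + 1) else -(k + 1))}
  have hset : {x : Option (Bool × ℕ × V) → V | x none = w 0 ∧
      (∀ k < n, x (some (true, k, w k)) = w (k + 1)) ∧
        ∀ k < m, x (some (false, k, w (-k))) = w (-(k + 1))} =
      Set.pi (Finset.insertNone s : Set (Option (Bool × ℕ × V))) t := by
    ext x
    simp only [Set.mem_ofPred_eq, Set.mem_pi, Finset.mem_coe]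
    constructor
    · rintro ⟨h0, h1, h2⟩ o ho
      match o with
      | none => exact h0
      | some y =>
        rw [Finset.some_mem_insertNone, Finset.mem_union] at ho
        rcases ho with ho | ho
        · obtain ⟨k, hk, rfl⟩ := Finset.mem_map.mp ho
          simpa [e, t] using h1 k (Finset.mem_range.mp hk)
        · obtain ⟨k, hk, rfl⟩ := Finset.mem_map.mp ho
          simpa [e, t] using h2 k (Finset.mem_range.mp hk)
    · intro h
      refine ⟨h none (by simp), fun k hk => ?_, fun k hk => ?_⟩
      · have := h (some (e true k)) (Finset.some_mem_insertNone.mpr (Finset.mem_union_left _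
          (Finset.mem_map_of_mem _ (Finset.mem_range.mpr hk))))
        simpa [e, t] using this
      · have := h (some (e false k)) (Finset.some_mem_insertNone.mpr (Finset.mem_union_right _
          (Finset.mem_map_of_mem _ (Finset.mem_range.mpr hk))))
        simpa [e, t] using this
  rw [hset, Measure.infinitePi_pi _ fun _ _ => MeasurableSet.of_discrete,
    Finset.prod_insertNone, Finset.prod_union hdisj, Finset.prod_map, Finset.prod_map]
  simp [e, t]

/-- The stationary two-sided Markov chain with initial distribution `π`, transition probabilities
`p` and backward transition probabilities `q`. -/
theorem exists_markov_measure [Countable V] (π : V → ℝ≥0∞) (p q : V → V → ℝ≥0∞)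
    (hπ : ∑' i, π i = 1) (hp : ∀ i, ∑' j, p i j = 1) (hq : ∀ i, ∑' j, q i j = 1)
    (hpq : ∀ i j, π i * p i j = π j * q j i) :
    ∃ μ : ProbabilityMeasure (ℤ → V), MeasurePreserving shift (μ : Measure (ℤ → V)) μ ∧
      ∀ (n : ℕ) (w : Fin (n + 1) → V), (μ : Measure (ℤ → V)) (cylinder w) =
        π (w 0) * ∏ i : Fin n, p (w i.castSucc) (w i.succ) := by
  -- The chain is driven by independent random self-maps of `V`, one for each time and direction,
  -- and a random starting vertex.
  let P : Option (Bool × ℕ × V) → PMF V := fun o =>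
    match o with
    | none => ⟨π, by rw [← hπ]; exact ENNReal.summable.hasSum⟩
    | some (true, _, i) => ⟨p i, by rw [← hp i]; exact ENNReal.summable.hasSum⟩
    | some (false, _, i) => ⟨q i, by rw [← hq i]; exact ENNReal.summable.hasSum⟩
  let ν : Option (Bool × ℕ × V) → Measure V := fun o => (P o).toMeasure
  have hν : ∀ o, IsProbabilityMeasure (ν o) := fun o => PMF.toMeasure.isProbabilityMeasure _
  let μ : Measure (ℤ → V) := (Measure.infinitePi ν).map twoSidedOrbit
  have hμ : IsProbabilityMeasure μ :=
    Measure.isProbabilityMeasure_map measurable_twoSidedOrbit.aemeasurable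
  -- The reversal identity `hpq` carries `π` back in time, turning each backward factor into a
  -- forward one.
  have hback : ∀ (m n : ℕ) (w : ℤ → V),
      π (w 0) * ((∏ k ∈ Finset.range n, p (w k) (w (k + 1))) *
        ∏ k ∈ Finset.range m, q (w (-k)) (w (-(k + 1)))) =
      π (w (-m)) * ∏ k ∈ Finset.range (m + n), p (w (-m + k)) (w (-m + k + 1)) := by
    intro m n w
    induction m with
    | zero => simp
    | succ m ih =>
      rw [Finset.prod_range_succ, ← mul_assoc, ← mul_assoc, mul_assoc (π (w 0)), ih,
        show m + 1 + n = (m + n) + 1 by ring, Finset.prod_range_succ']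
      have h1 : ∀ k : ℕ, -((m + 1 : ℕ) : ℤ) + ((k + 1 : ℕ) : ℤ) = -m + k := by
        intro k
        push_cast
        ring
      simp_rw [h1]
      have h2 : -((m + 1 : ℕ) : ℤ) + ((0 : ℕ) : ℤ) = -(m + 1) := by push_cast; ring
      have h3 : -((m : ℤ) + 1) + 1 = -m := by ring
      rw [h2, h3, Nat.cast_succ]
      calc _ = (π (w (-m)) * q (w (-m)) (w (-(m + 1)))) *
            ∏ k ∈ Finset.range (m + n), p (w (-m + k)) (w (-m + k + 1)) := by ring
        _ = _ := by rw [← hpq]; ring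
  have hwin : ∀ (m n : ℕ) (w : ℤ → V), μ (windowSet (-m) n w) =
      π (w (-m)) * ∏ k ∈ Finset.range (m + n), p (w (-m + k)) (w (-m + k + 1)) := by
    intro m n w
    rw [Measure.map_apply measurable_twoSidedOrbit (measurableSet_windowSet _ _ _),
      preimage_twoSidedOrbit_windowSet, infinitePi_orbit_event, ← hback]
    congr 1
    · exact PMF.toMeasure_apply_singleton _ _ (MeasurableSet.of_discrete)
    · congr 1
      · refine Finset.prod_congr rfl fun k _ => ?_
        exact PMF.toMeasure_apply_singleton _ _ (MeasurableSet.of_discrete)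
      · refine Finset.prod_congr rfl fun k _ => ?_
        exact PMF.toMeasure_apply_singleton _ _ (MeasurableSet.of_discrete)
  refine ⟨⟨μ, hμ⟩, ⟨measurable_shiftBy 1, ?_⟩, ?_⟩
  · change μ.map shift = μ
    have : IsProbabilityMeasure (μ.map shift) :=
      Measure.isProbabilityMeasure_map (measurable_shiftBy 1).aemeasurable
    apply ext_of_symmWindows
    rintro _ ⟨m, w, rfl⟩
    have hpre : shift ⁻¹' windowSet (-((m : ℤ) + 1)) (m + 1) w =
        windowSet (-m) ((m + 2 : ℕ) : ℤ) fun k => w (k - 1) := by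
      ext ω
      constructor
      · intro h k hk hk'
        have := h (k - 1) (by omega) (by push_cast at hk'; omega)
        simpa [shift] using this
      · intro h k hk hk'
        have := h (k + 1) (by omega) (by push_cast; omega)
        simpa [shift] using this
    have hmap : μ.map shift (windowSet (-((m : ℤ) + 1)) (m + 1) w) =
        μ (shift ⁻¹' windowSet (-((m : ℤ) + 1)) (m + 1) w) :=
      Measure.map_apply (measurable_shiftBy 1) (measurableSet_windowSet _ _ _)
    have hwin' := hwin (m + 1) (m + 1) w
    rw [Nat.cast_succ] at hwin'
    rw [hmap, hpre, hwin, hwin', show m + (m + 2) = m + 1 + (m + 1) by ring]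
    congr 1
    · congr 2
      ring
    · refine Finset.prod_congr rfl fun k _ => ?_
      congr 2 <;> ring
  · intro n w
    -- Clamping the index extends the word to all times; the values outside the window are
    -- irrelevant.
    have hcyl : cylinder w =
        windowSet (-(0 : ℕ)) n fun k => w ⟨min k.toNat n, by omega⟩ := by
      ext ω
      constructor
      · intro h k hk hk'
        have := h ⟨k.toNat, by omega⟩
        have e : ((k.toNat : ℕ) : ℤ) = k := Int.toNat_of_nonneg (by simpa using hk)
        simp only [e] at this
        rw [this]
        congr 1
        ext
        simp
        omega
      · intro h k
        refine (h (k : ℕ) (by simp) (by omega)).trans (congrArg w ?_)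
        ext
        simp
        omega
    change μ (cylinder w) = _
    rw [hcyl, hwin, zero_add, ← Fin.prod_univ_eq_prod_range (fun k : ℕ => p _ _) n]
    congr 1
    refine Finset.prod_congr rfl fun k _ => ?_
    have hk := k.2
    congr 2
    · ext
      simp
    · ext
      simp

end Sequences


/-! ### Gibbs' inequality and integrable coboundaries -/

/-- This is `log x ≤ x - 1` at `x = M * p / m`, which is strict for `x ≠ 1`. -/
lemma mul_log_div_le {m M p : ℝ} (hm : 0 < m) (hM : m ≤ M) (hp : 0 < p) :
    m * Real.log (M / m) ≤ m * -Real.log p + (M * p - m) ∧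
      (m * Real.log (M / m) = m * -Real.log p + (M * p - m) → m = M * p) := by
  have hM0 : 0 < M := hm.trans_le hM
  have hx : 0 < M * p / m := by positivity
  have e : Real.log (M * p / m) = Real.log (M / m) + Real.log p := by
    rw [Real.log_div (by positivity) hm.ne', Real.log_mul hM0.ne' hp.ne',
      Real.log_div hM0.ne' hm.ne']
    ring
  have e2 : m * (M * p / m - 1) = M * p - m := by field_simp
  constructor
  · have := mul_le_mul_of_nonneg_left (Real.log_le_sub_one_of_pos hx) hm.le
    rw [e2, e] at this
    linarith
  · intro h
    by_contra hne
    have hx1 : M * p / m ≠ 1 := fun h1 => hne (by field_simp at h1; exact h1.symm)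
    have := mul_lt_mul_of_pos_left (Real.log_lt_sub_one_of_pos hx hx1) hm
    rw [e2, e] at this
    linarith

/-- Gibbs' inequality, with the case of equality. -/
lemma tsum_mul_log_le {α : Type*} (m M p : α → ℝ) (hm : ∀ a, 0 ≤ m a) (hM : ∀ a, m a ≤ M a)
    (hp : ∀ a, 0 ≤ p a) (hp1 : ∀ a, p a ≤ 1) (hpos : ∀ a, m a ≠ 0 → p a ≠ 0)
    (hm1 : HasSum m 1) (hMp : HasSum (fun a => M a * p a) 1) :
    ∑' a, ENNReal.ofReal (m a * Real.log (M a / m a)) ≤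
        ∑' a, ENNReal.ofReal (m a * -Real.log (p a)) ∧
      (∑' a, ENNReal.ofReal (m a * -Real.log (p a)) ≠ ∞ →
        ∑' a, ENNReal.ofReal (m a * -Real.log (p a)) ≤
          ∑' a, ENNReal.ofReal (m a * Real.log (M a / m a)) → ∀ a, m a = M a * p a) := by
  have hM0 : ∀ a, 0 ≤ M a := fun a => (hm a).trans (hM a)
  have hterm : ∀ a, m a * Real.log (M a / m a) ≤ m a * -Real.log (p a) + (M a * p a - m a) ∧
      (m a * Real.log (M a / m a) = m a * -Real.log (p a) + (M a * p a - m a) →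
        m a = M a * p a) := by
    intro a
    rcases (hm a).eq_or_lt with h0 | h0
    · rw [← h0]
      have := mul_nonneg (hM0 a) (hp a)
      simp only [zero_mul, zero_add, sub_zero]
      exact ⟨this, id⟩
    · exact mul_log_div_le h0 (hM a) ((hp a).lt_of_ne' (hpos a h0.ne'))
  have hnn : ∀ a, 0 ≤ m a * Real.log (M a / m a) := by
    intro a
    rcases (hm a).eq_or_lt with h0 | h0
    · simp [← h0]
    · exact mul_nonneg (hm a) (Real.log_nonneg ((one_le_div h0).mpr (hM a)))
  have hnn' : ∀ a, 0 ≤ m a * -Real.log (p a) := fun a =>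
    mul_nonneg (hm a) (neg_nonneg.mpr (Real.log_nonpos (hp a) (hp1 a)))
  by_cases htop : ∑' a, ENNReal.ofReal (m a * -Real.log (p a)) = ∞
  · exact ⟨htop ▸ le_top, fun h => absurd htop h⟩
  have hS : Summable fun a => m a * -Real.log (p a) := by
    have := ENNReal.summable_toReal htop
    simpa only [ENNReal.toReal_ofReal (hnn' _)] using this
  have hS2 : Summable fun a => m a * -Real.log (p a) + (M a * p a - m a) :=
    hS.add (hMp.summable.sub hm1.summable)
  have hL : Summable fun a => m a * Real.log (M a / m a) :=
    hS2.of_nonneg_of_le hnn fun a => (hterm a).1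
  -- The correction terms cancel in the sum, as both families have total mass 1.
  have hsum : ∑' a, (m a * -Real.log (p a) + (M a * p a - m a)) = ∑' a, m a * -Real.log (p a) := by
    rw [hS.tsum_add (hMp.summable.sub hm1.summable), hMp.summable.tsum_sub hm1.summable,
      hMp.tsum_eq, hm1.tsum_eq]
    ring
  rw [← ENNReal.ofReal_tsum_of_nonneg hnn hL, ← ENNReal.ofReal_tsum_of_nonneg hnn' hS]
  constructor
  · rw [← hsum]
    exact ENNReal.ofReal_le_ofReal (hL.tsum_le_tsum (fun a => (hterm a).1) hS2)
  · intro _ hle a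
    apply (hterm a).2
    have hle' := (ENNReal.ofReal_le_ofReal_iff (tsum_nonneg hnn)).mp hle
    by_contra hne
    have hlt := Summable.tsum_lt_tsum (fun a => (hterm a).1)
      (lt_of_le_of_ne (hterm a).1 hne) hL hS2
    rw [hsum] at hlt
    linarith

/-- A coboundary whose negative part is integrable is integrable, with integral zero. -/
lemma integrable_coboundary {Ω : Type*} [MeasurableSpace Ω] {μ : Measure Ω}
    [IsProbabilityMeasure μ] {T : Ω → Ω} (hT : MeasurePreserving T μ μ) {k c : Ω → ℝ}
    (hk : Measurable k) (hc : ∀ ω, 0 ≤ c ω)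
    (hint : Integrable (fun ω => k ω - k (T ω) - c ω) μ) :
    Integrable (fun ω => k ω - k (T ω)) μ ∧ ∫ ω, (k ω - k (T ω)) ∂μ = 0 := by
  set D : Ω → ℝ := fun ω => k ω - k (T ω) with hD
  set f : Ω → ℝ := fun ω => k ω - k (T ω) - c ω with hf
  let cl : ℕ → ℝ → ℝ := fun M x => max (-M) (min M x)
  let DM : ℕ → Ω → ℝ := fun M ω => cl M (k ω) - cl M (k (T ω))
  have hclm : ∀ M, Measurable (cl M) := fun M =>
    measurable_const.max (measurable_const.min measurable_id)
  have hclb : ∀ (M : ℕ) x, |cl M x| ≤ M := by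
    intro M x
    have : (0 : ℝ) ≤ M := Nat.cast_nonneg M
    simp only [cl]
    rw [abs_le]
    constructor
    · exact le_max_left _ _
    · exact max_le (by linarith) (min_le_left _ _)
  have hDm : Measurable D := hk.sub (hk.comp hT.measurable)
  have hDMm : ∀ M, Measurable (DM M) := fun M =>
    ((hclm M).comp hk).sub ((hclm M).comp (hk.comp hT.measurable))
  have hclint : ∀ M, Integrable (fun ω => cl M (k ω)) μ := fun M =>
    Integrable.of_bound ((hclm M).comp hk).aestronglyMeasurable M
      (ae_of_all _ fun ω => hclb M (k ω))
  have hclint' : ∀ M, Integrable (fun ω => cl M (k (T ω))) μ := fun M =>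
    (hT.integrable_comp_of_integrable (hclint M))
  have hDMint : ∀ M, Integrable (DM M) μ := fun M => (hclint M).sub (hclint' M)
  have hDM0 : ∀ M, ∫ ω, DM M ω ∂μ = 0 := by
    intro M
    rw [integral_sub (hclint M) (hclint' M), sub_eq_zero]
    have hmap : ∫ y, cl M (k y) ∂(μ.map T) = ∫ ω, cl M (k (T ω)) ∂μ :=
      integral_map hT.measurable.aemeasurable ((hclm M).comp hk).aestronglyMeasurable
    rw [← hmap, hT.map_eq]
  -- Truncation is monotone and 1-Lipschitz. Where `DM` is negative, `f ≤ D ≤ 0`, so its size is at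
  -- most `|f|`. As `DM` has integral zero, its L¹ norm is bounded independently of `M`.
  have hDMle : ∀ M ω, |DM M ω| ≤ DM M ω + 2 * |f ω| ∧ |DM M ω| ≤ |D ω| := by
    intro M ω
    have h1 : D ω = f ω + c ω := by simp [hD, hf]
    have h2 := hc ω
    have hM : (0 : ℝ) ≤ M := Nat.cast_nonneg M
    have hlip : |DM M ω| ≤ |D ω| :=
      (abs_max_sub_max_le_max _ _ _ _).trans (max_le (by simp)
        ((abs_min_sub_min_le_max _ _ _ _).trans (max_le (by simp) le_rfl)))
    refine ⟨?_, hlip⟩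
    rcases le_or_gt 0 (DM M ω) with h | h
    · rw [abs_of_nonneg h]
      have := abs_nonneg (f ω)
      linarith
    · have hneg : D ω ≤ 0 := by
        by_contra hcon
        push Not at hcon
        have hkk : k (T ω) ≤ k ω := by simp only [hD] at hcon; linarith
        have : cl M (k (T ω)) ≤ cl M (k ω) := max_le_max le_rfl (min_le_min le_rfl hkk)
        exact absurd (sub_nonneg.mpr this) (not_le.mpr h)
      rw [abs_of_nonpos h.le] at hlip ⊢
      rw [abs_of_nonpos hneg] at hlip
      have := neg_abs_le (f ω)
      linarith
  have hlim : ∀ ω, Tendsto (fun M => DM M ω) atTop (𝓝 (D ω)) := by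
    have hcl : ∀ x, Tendsto (fun M => cl M x) atTop (𝓝 x) := by
      intro x
      obtain ⟨M₀, hM₀⟩ := exists_nat_ge |x|
      apply tendsto_const_nhds.congr'
      filter_upwards [eventually_ge_atTop M₀] with M hM
      have hM' : (M₀ : ℝ) ≤ M := by exact_mod_cast hM
      have := abs_le.mp (hM₀.trans hM')
      simp only [cl]
      rw [min_eq_right this.2, max_eq_right this.1]
    exact fun ω => (hcl _).sub (hcl _)
  have hbound : ∀ M, ∫⁻ ω, ‖DM M ω‖ₑ ∂μ ≤ ENNReal.ofReal (∫ ω, 2 * |f ω| ∂μ) := by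
    intro M
    have hfa : Integrable (fun ω => 2 * |f ω|) μ := hint.abs.const_mul 2
    have := integral_mono (hDMint M).abs ((hDMint M).add hfa) fun ω => (hDMle M ω).1
    simp only [Pi.add_apply] at this
    rw [integral_add (hDMint M) hfa, hDM0, zero_add] at this
    rw [← ofReal_integral_norm_eq_lintegral_enorm (hDMint M)]
    exact ENNReal.ofReal_le_ofReal this
  -- Fatou's lemma passes the uniform bound to the limit; dominated convergence then gives the value
  -- of the integral.
  have hDint : Integrable D μ := by
    refine ⟨hDm.aestronglyMeasurable, ?_⟩
    have h1 : ∀ ω, ‖D ω‖ₑ = liminf (fun M => ‖DM M ω‖ₑ) atTop := fun ω =>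
      (((continuous_enorm.tendsto _).comp (hlim ω)).liminf_eq).symm
    rw [HasFiniteIntegral]
    simp_rw [h1]
    refine (lintegral_liminf_le fun M => (hDMm M).enorm).trans_lt ?_
    refine lt_of_le_of_lt (b := ENNReal.ofReal (∫ ω, 2 * |f ω| ∂μ)) ?_ ENNReal.ofReal_lt_top
    exact (liminf_le_liminf (Eventually.of_forall hbound)).trans_eq (liminf_const _)
  refine ⟨hDint, ?_⟩
  have := tendsto_integral_of_dominated_convergence (fun ω => |D ω|)
    (fun M => (hDMm M).aestronglyMeasurable) hDint.abs
    (fun M => ae_of_all _ fun ω => (hDMle M ω).2) (ae_of_all _ hlim)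
  simp_rw [hDM0] at this
  exact tendsto_nhds_unique this tendsto_const_nhds

/-! ### Entropy and cross entropy -/

section Entropy

variable {V : Type*}

lemma hasSum_toReal_of_tsum_eq_one {α : Type*} {f : α → ℝ≥0∞} (h : ∑' a, f a = 1) :
    HasSum (fun a => (f a).toReal) 1 := by
  have htop : ∑' a, f a ≠ ∞ := by rw [h]; exact ENNReal.one_ne_top
  have h1 := ENNReal.hasSum_toReal htop
  rwa [← ENNReal.tsum_toReal_eq (ENNReal.ne_top_of_tsum_ne_top htop), h,
    ENNReal.toReal_one] at h1

/-- The information content of a transition. -/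
def surprisal (p : V → V → ℝ≥0∞) (i j : V) : ℝ := -Real.log (p i j).toReal

/-- The word read at the times `0, …, n - 1`. -/
def wordAt (n : ℕ) (ω : ℤ → V) : Fin n → V := fun i => ω (i : ℕ)

variable {p : V → V → ℝ≥0∞}

lemma prob_ne_top (hp : ∀ i, ∑' j, p i j = 1) (i j : V) : p i j ≠ ∞ :=
  ENNReal.ne_top_of_tsum_ne_top (by rw [hp i]; simp) j

lemma toReal_prob_le_one (hp : ∀ i, ∑' j, p i j = 1) (i j : V) : (p i j).toReal ≤ 1 := by
  have h : p i j ≤ 1 := (hp i) ▸ ENNReal.le_tsum j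
  exact ENNReal.toReal_mono ENNReal.one_ne_top h |>.trans_eq ENNReal.toReal_one

lemma surprisal_nonneg (hp : ∀ i, ∑' j, p i j = 1) (i j : V) : 0 ≤ surprisal p i j :=
  neg_nonneg.mpr (Real.log_nonpos ENNReal.toReal_nonneg (toReal_prob_le_one hp i j))

variable [MeasurableSpace V]

variable {ν : Measure (ℤ → V)}

lemma measureReal_cylinder_le [IsProbabilityMeasure ν] {n : ℕ} (u : Fin (n + 1) → V) :
    ν.real (cylinder u) ≤ ν.real (cylinder (Fin.init u)) :=
  measureReal_mono fun _ h i => h i.castSucc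

lemma ofReal_measureReal_mul [IsProbabilityMeasure ν] (s : Set (ℤ → V)) (x : ℝ) :
    ENNReal.ofReal (ν.real s * x) = ENNReal.ofReal x * ν s := by
  rw [ENNReal.ofReal_mul measureReal_nonneg, Measure.real,
    ENNReal.ofReal_toReal (measure_ne_top _ _), mul_comm]

variable [DiscreteMeasurableSpace V] [Countable V]

variable (ν) in
lemma tsum_mul_cylinder (n : ℕ) (f : (Fin n → V) → ℝ≥0∞) :
    ∑' u, f u * ν (cylinder u) = ∫⁻ ω, f (wordAt n ω) ∂ν := by
  have hw : Measurable (wordAt n : (ℤ → V) → Fin n → V) :=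
    measurable_pi_lambda _ fun _ => measurable_pi_apply _
  have hf : Measurable f := Measurable.of_discrete
  rw [← lintegral_map hf hw, lintegral_countable']
  congr with u
  rw [Measure.map_apply hw (MeasurableSet.singleton u)]
  congr 2
  ext ω
  exact ⟨fun h => funext fun i => h i, fun h i => congrFun h i⟩

lemma tsum_cylinder [IsProbabilityMeasure ν] (n : ℕ) :
    ∑' u : Fin n → V, ν (cylinder u) = 1 := by
  have := tsum_mul_cylinder ν n fun _ => 1
  simpa using this

lemma hasSum_measureReal_cylinder [IsProbabilityMeasure ν] (n : ℕ) :
    HasSum (fun u : Fin n → V => ν.real (cylinder u)) 1 :=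
  hasSum_toReal_of_tsum_eq_one (tsum_cylinder n)

/-- The expected information content of a transition. -/
def crossEntropy (p : V → V → ℝ≥0∞) (ν : Measure (ℤ → V)) : ℝ≥0∞ :=
  ∫⁻ ω, ENNReal.ofReal (surprisal p (ω 0) (ω 1)) ∂ν

lemma lintegral_pair_eq (hν : MeasurePreserving shift ν ν) (f : V → V → ℝ≥0∞) (n : ℕ) :
    ∫⁻ ω, f (ω n) (ω (n + 1 : ℕ)) ∂ν = ∫⁻ ω, f (ω 0) (ω 1) ∂ν := by
  have hf : Measurable fun ω : ℤ → V => f (ω 0) (ω 1) := by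
    have h1 : Measurable (Function.uncurry f) := Measurable.of_discrete
    have h2 : Measurable fun ω : ℤ → V => (ω 0, ω 1) :=
      (measurable_pi_apply _).prodMk (measurable_pi_apply _)
    exact h1.comp h2
  rw [← (measurePreserving_shiftBy hν n).lintegral_comp hf]
  simp [shiftBy, add_comm]

lemma crossEntropy_eq_tsum (hν : MeasurePreserving shift ν ν) (n : ℕ) :
    crossEntropy p ν = ∑' u : Fin (n + 2) → V,
      ENNReal.ofReal (surprisal p (u (Fin.last n).castSucc) (u (Fin.last (n + 1)))) *
        ν (cylinder u) := by
  rw [tsum_mul_cylinder ν (n + 2) fun u =>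
      ENNReal.ofReal (surprisal p (u (Fin.last n).castSucc) (u (Fin.last (n + 1)))),
    crossEntropy, ← lintegral_pair_eq hν (fun i j => ENNReal.ofReal (surprisal p i j)) n]
  rfl

/-- Continuing a random word by one step of the chain gives a probability law; it is the reference
law in Gibbs' inequality. -/
lemma tsum_cylinder_init_mul [IsProbabilityMeasure ν] (hp : ∀ i, ∑' j, p i j = 1) (n : ℕ) :
    ∑' u : Fin (n + 2) → V, ν (cylinder (Fin.init u)) *
      p (u (Fin.last n).castSucc) (u (Fin.last (n + 1))) = 1 := by
  rw [← (Fin.snocEquiv fun _ => V).tsum_eq, ENNReal.tsum_prod', ENNReal.tsum_comm]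
  have h : ∀ (w : Fin (n + 1) → V), ∑' a : V,
      ν (cylinder (Fin.init ((Fin.snocEquiv fun _ => V) (a, w)))) *
        p ((Fin.snocEquiv fun _ => V) (a, w) (Fin.last n).castSucc)
          ((Fin.snocEquiv fun _ => V) (a, w) (Fin.last (n + 1))) = ν (cylinder w) := by
    intro w
    have hi : ∀ a : V, (Fin.init ((Fin.snocEquiv fun _ => V) (a, w)) : Fin (n + 1) → V) = w :=
      fun a => Fin.init_snoc (α := fun _ => V) a w
    simp only [hi, Fin.snocEquiv_apply, Fin.snoc_castSucc, Fin.snoc_last]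
    rw [ENNReal.tsum_mul_left, hp, mul_one]
  exact (tsum_congr h).trans (tsum_cylinder _)

/-- The conditional entropy is at most the cross entropy, with equality only for the transition
probabilities themselves. -/
lemma condEntropy_le_crossEntropy [IsProbabilityMeasure ν] (hν : MeasurePreserving shift ν ν)
    (hp : ∀ i, ∑' j, p i j = 1) (n : ℕ)
    (hsupp : ∀ u : Fin (n + 2) → V, ν (cylinder u) ≠ 0 →
      p (u (Fin.last n).castSucc) (u (Fin.last (n + 1))) ≠ 0) :
    condEntropy ν (n + 1) ≤ crossEntropy p ν ∧
      (crossEntropy p ν ≠ ∞ → crossEntropy p ν ≤ condEntropy ν (n + 1) →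
        ∀ u : Fin (n + 2) → V, ν (cylinder u) =
          ν (cylinder (Fin.init u)) * p (u (Fin.last n).castSucc) (u (Fin.last (n + 1)))) := by
  have hMp : HasSum (fun u : Fin (n + 2) → V => ν.real (cylinder (Fin.init u)) *
      (p (u (Fin.last n).castSucc) (u (Fin.last (n + 1)))).toReal) 1 := by
    have h := hasSum_toReal_of_tsum_eq_one (tsum_cylinder_init_mul (ν := ν) hp n)
    simpa only [Measure.real, ENNReal.toReal_mul] using h
  have key := tsum_mul_log_le (fun u : Fin (n + 2) → V => ν.real (cylinder u))
    (fun u => ν.real (cylinder (Fin.init u)))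
    (fun u => (p (u (Fin.last n).castSucc) (u (Fin.last (n + 1)))).toReal)
    (fun _ => measureReal_nonneg) measureReal_cylinder_le (fun _ => ENNReal.toReal_nonneg)
    (fun _ => toReal_prob_le_one hp _ _)
    (fun u hu => by
      rw [ENNReal.toReal_ne_zero]
      exact ⟨hsupp u fun h0 => hu (by simp [Measure.real, h0]), prob_ne_top hp _ _⟩)
    (hasSum_measureReal_cylinder _) hMp
  have hE : ∑' u : Fin (n + 2) → V, ENNReal.ofReal (ν.real (cylinder u) *
      -Real.log (p (u (Fin.last n).castSucc) (u (Fin.last (n + 1)))).toReal) =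
      crossEntropy p ν := by
    rw [crossEntropy_eq_tsum hν n]
    exact tsum_congr fun u => ofReal_measureReal_mul _ _
  rw [hE] at key
  refine ⟨key.1, fun h h' u => ?_⟩
  have := key.2 h h' u
  rw [Measure.real, Measure.real, ← ENNReal.toReal_mul, ENNReal.toReal_eq_toReal_iff'] at this
  · exact this
  · exact measure_ne_top _ _
  · exact ENNReal.mul_ne_top (measure_ne_top _ _) (prob_ne_top hp _ _)

/-- The infimum defining the entropy includes the index 0, where there is no preceding vertex to
condition on. Gibbs' inequality is applied to transitions that ignore the present vertex and follow
the marginal law. -/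
lemma condEntropy_one_le_zero [IsProbabilityMeasure ν] (hν : MeasurePreserving shift ν ν) :
    condEntropy ν 1 ≤ condEntropy ν 0 := by
  have hp : ∀ _ : V, ∑' j, ν (cylinder ![j]) = 1 := by
    intro _
    rw [← tsum_cylinder (ν := ν) 1, ← (Equiv.funUnique (Fin 1) V).symm.tsum_eq]
    refine tsum_congr fun a => ?_
    congr 2
    funext k
    simp
  refine (condEntropy_le_crossEntropy hν hp 0 ?_).1.trans_eq ?_
  · intro u hu h0
    apply hu
    refine measure_mono_null ?_ (((measurePreserving_shiftBy hν 1).measure_preimage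
      (measurableSet_cylinder ![u 1]).nullMeasurableSet).trans h0)
    intro ω hω i
    have := hω 1
    simpa [shiftBy, Subsingleton.elim i 0] using this
  · have h1 : Measurable fun j : V => ENNReal.ofReal (-Real.log (ν (cylinder ![j])).toReal) :=
      Measurable.of_discrete
    have h2 := (measurePreserving_shiftBy hν 1).lintegral_comp (h1.comp (measurable_pi_apply 0))
    have h3 := tsum_mul_cylinder ν 1 fun u =>
      ENNReal.ofReal (-Real.log (ν (cylinder u)).toReal)
    have h4 : ∀ ω : ℤ → V, wordAt 1 ω = ![ω 0] := fun ω => by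
      funext i
      simp [wordAt, Subsingleton.elim i 0]
    simp_rw [h4] at h3
    rw [crossEntropy, condEntropy]
    calc _ = _ := h2
      _ = _ := h3.symm
      _ = _ := by
        refine tsum_congr fun u => ?_
        have h5 : (cylinder (Fin.init u) : Set (ℤ → V)) = Set.univ :=
          Set.eq_univ_of_forall fun ω i => i.elim0
        rw [h5, probReal_univ, one_div, Real.log_inv, ofReal_measureReal_mul]
        rfl

lemma condEntropy_eq_crossEntropy_of_markov [IsProbabilityMeasure ν]
    (hν : MeasurePreserving shift ν ν) (n : ℕ)
    (h : ∀ u : Fin (n + 2) → V, ν (cylinder u) =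
      ν (cylinder (Fin.init u)) * p (u (Fin.last n).castSucc) (u (Fin.last (n + 1)))) :
    condEntropy ν (n + 1) = crossEntropy p ν := by
  rw [crossEntropy_eq_tsum hν n, condEntropy]
  refine tsum_congr fun u => ?_
  rw [← ofReal_measureReal_mul]
  congr 1
  by_cases h0 : ν.real (cylinder u) = 0
  · rw [h0, zero_mul, zero_mul]
  · congr 1
    have h1 : ν.real (cylinder u) = ν.real (cylinder (Fin.init u)) *
        (p (u (Fin.last n).castSucc) (u (Fin.last (n + 1)))).toReal := by
      rw [Measure.real, h u, ENNReal.toReal_mul]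
      rfl
    have h2 : ν.real (cylinder (Fin.init u)) ≠ 0 := fun h3 => h0 (by rw [h1, h3, zero_mul])
    rw [h1, surprisal, ← Real.log_inv]
    congr 1
    rw [div_mul_eq_div_div, div_self h2, one_div]

lemma entropy_eq_crossEntropy_of_markov [IsProbabilityMeasure ν]
    (hν : MeasurePreserving shift ν ν)
    (h : ∀ (n : ℕ) (u : Fin (n + 2) → V), ν (cylinder u) =
      ν (cylinder (Fin.init u)) * p (u (Fin.last n).castSucc) (u (Fin.last (n + 1)))) :
    entropy ν = crossEntropy p ν := by
  apply le_antisymm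
  · exact (iInf_le _ 1).trans_eq (condEntropy_eq_crossEntropy_of_markov hν 0 (h 0))
  · refine le_iInf fun n => ?_
    cases n with
    | zero =>
      rw [← condEntropy_eq_crossEntropy_of_markov hν 0 (h 0)]
      exact condEntropy_one_le_zero hν
    | succ n => exact (condEntropy_eq_crossEntropy_of_markov hν n (h n)).ge

/-- Computation of the free energy if the weights are cohomologous to transition probabilities. -/
lemma freeEnergy_eq [IsProbabilityMeasure ν] (hν : MeasurePreserving shift ν ν)
    (hp : ∀ i, ∑' j, p i j = 1) {W : V → V → ℝ≥0} {κ : V → ℝ} {P : ℝ}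
    (hW : ∀ᵐ ω ∂ν, Real.log (W (ω 0) (ω 1)) = P - surprisal p (ω 0) (ω 1) + κ (ω 0) - κ (ω 1)) :
    (crossEntropy p ν = ∞ → freeEnergy W ν = ⊥) ∧
    (crossEntropy p ν ≠ ∞ → freeEnergy W ν =
      (entropy ν : EReal) + ((P - (crossEntropy p ν).toReal : ℝ) : EReal)) := by
  have hev : ∀ i : ℤ, Measurable fun ω : ℤ → V => ω i := fun i => measurable_pi_apply i
  have hs : Measurable fun ω : ℤ → V => surprisal p (ω 0) (ω 1) :=
    (Measurable.of_discrete (f := Function.uncurry (surprisal p))).comp ((hev 0).prodMk (hev 1))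
  -- Every candidate integrand is a constant plus the coboundary of `g + κ` minus a nonnegative
  -- function.
  have hadm : ∀ g : V → ℝ,
      (fun ω : ℤ → V => Real.log (W (ω 0) (ω 1)) + g (ω 0) - g (ω 1)) =ᵐ[ν]
        fun ω => P + (((g + κ) (ω 0) - (g + κ) (shift ω 0)) - surprisal p (ω 0) (ω 1)) := by
    intro g
    filter_upwards [hW] with ω hω
    rw [hω]
    simp only [shift, zero_add, Pi.add_apply]
    ring
  have hkm : ∀ g : V → ℝ, Measurable fun ω : ℤ → V => (g + κ) (ω 0) := fun g =>
    (Measurable.of_discrete (f := g + κ)).comp (hev 0)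
  -- Integrability of the difference forces the coboundary and the surprisal to be integrable
  -- separately, so all admissible `g` give one value.
  have hval : ∀ g : V → ℝ,
      Integrable (fun ω : ℤ → V => Real.log (W (ω 0) (ω 1)) + g (ω 0) - g (ω 1)) ν →
      crossEntropy p ν ≠ ∞ ∧
        ∫ ω : ℤ → V, (Real.log (W (ω 0) (ω 1)) + g (ω 0) - g (ω 1)) ∂ν =
          P - (crossEntropy p ν).toReal := by
    intro g hg
    rw [integrable_congr (hadm g)] at hg
    have hg' : Integrable (fun ω : ℤ → V =>
        ((g + κ) (ω 0) - (g + κ) (shift ω 0)) - surprisal p (ω 0) (ω 1)) ν := by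
      have := hg.sub (integrable_const P)
      refine this.congr (ae_of_all _ fun ω => ?_)
      simp
    obtain ⟨hi, h0⟩ := integrable_coboundary hν (hkm g)
      (fun ω => surprisal_nonneg hp (ω 0) (ω 1)) hg'
    have hsi : Integrable (fun ω : ℤ → V => surprisal p (ω 0) (ω 1)) ν := by
      have := hi.sub hg'
      refine this.congr (ae_of_all _ fun ω => ?_)
      simp
    have hE : crossEntropy p ν = ENNReal.ofReal (∫ ω : ℤ → V, surprisal p (ω 0) (ω 1) ∂ν) :=
      (ofReal_integral_eq_lintegral_ofReal hsi
        (ae_of_all _ fun ω => surprisal_nonneg hp (ω 0) (ω 1))).symm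
    refine ⟨by rw [hE]; exact ENNReal.ofReal_ne_top, ?_⟩
    rw [hE, ENNReal.toReal_ofReal (integral_nonneg fun ω : ℤ → V => surprisal_nonneg hp (ω 0) (ω 1)),
      integral_congr_ae (hadm g), integral_add (integrable_const P) hg', integral_sub hi hsi, h0]
    simp
    ring
  constructor
  · intro htop
    rw [freeEnergy]
    simp only [iSup_eq_bot]
    exact fun g hg => absurd htop (hval g hg).1
  · intro hfin
    apply le_antisymm
    · refine iSup₂_le fun g hg => ?_
      rw [(hval g hg).2]
    -- The choice `g = -κ` cancels the coboundary, so it is admissible as soon as the cross entropy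
    -- is finite.
    · have hg : Integrable (fun ω : ℤ → V =>
          Real.log (W (ω 0) (ω 1)) + (-κ) (ω 0) - (-κ) (ω 1)) ν := by
        rw [integrable_congr (hadm (-κ))]
        have hsi : Integrable (fun ω : ℤ → V => surprisal p (ω 0) (ω 1)) ν := by
          refine ⟨hs.aestronglyMeasurable, ?_⟩
          rw [hasFiniteIntegral_iff_ofReal
            (ae_of_all _ fun ω : ℤ → V => surprisal_nonneg hp (ω 0) (ω 1))]
          exact hfin.lt_top
        refine ((integrable_const P).sub hsi).congr (ae_of_all _ fun ω => ?_)
        simp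
        ring
      rw [← (hval _ hg).2]
      exact le_iSup₂ (f := fun (g : V → ℝ) (_ : Integrable (fun ω : ℤ → V =>
        Real.log (W (ω 0) (ω 1)) + g (ω 0) - g (ω 1)) ν) => (entropy ν : EReal) +
        ((∫ ω : ℤ → V, (Real.log (W (ω 0) (ω 1)) + g (ω 0) - g (ω 1)) ∂ν : ℝ) : EReal))
        (-κ) hg

end Entropy


/-! ### Equilibrium measures of recurrent loaded graphs -/

section Equilibrium

variable {V : Type*}

open Classical in
/-- The transition probabilities of the Markov chain given by the harmonic function `h` of the
matrix `B`. They are only relevant where `h` is positive. -/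
def doobTransform (B : V → V → ℝ≥0∞) (v : V) (h : V → ℝ≥0∞) (i j : V) : ℝ≥0∞ :=
  -- The point mass at `v` is a default row that keeps the matrix stochastic.
  if h i = 0 ∨ h i = ∞ then (if j = v then 1 else 0) else B i j * h j / h i

lemma tsum_doobTransform {B : V → V → ℝ≥0∞} (v : V) {h : V → ℝ≥0∞}
    (hh : ∀ i, h i = ∑' j, B i j * h j) (i : V) : ∑' j, doobTransform B v h i j = 1 := by
  classical
  by_cases h0 : h i = 0 ∨ h i = ∞
  · simp [doobTransform, h0]
  · simp only [doobTransform, if_neg h0, div_eq_mul_inv]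
    rw [ENNReal.tsum_mul_right, ← hh i]
    push Not at h0
    exact ENNReal.mul_inv_cancel h0.1 h0.2

/-- If `h i = 0`, harmonicity makes every `B i j * h j` vanish, so the default row does no harm. -/
lemma mul_doobTransform {B : V → V → ℝ≥0∞} (v : V) {h : V → ℝ≥0∞}
    (hh : ∀ i, h i = ∑' j, B i j * h j) {i : V} (hi : h i ≠ ∞) (j : V) :
    h i * doobTransform B v h i j = B i j * h j := by
  by_cases h0 : h i = 0
  · have h1 := hh i
    rw [h0, eq_comm, ENNReal.tsum_eq_zero] at h1
    rw [h0, zero_mul, h1 j]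
  · rw [doobTransform, if_neg (by tauto), ENNReal.mul_div_cancel h0 hi]

/-- Uniqueness of the stationary distribution of the transformed chain: a stationary distribution
carried by the vertices where `h` is positive is determined by its value at `v`. -/
lemma stationary_unique {A : V → V → ℝ≥0∞} {v : V} {z : ℝ≥0∞} (hz0 : z ≠ 0)
    (h1 : hitSum A v z v = 1) (hfin : ∀ i, hitSum A v z i ≠ ∞)
    {m : V → ℝ≥0∞} (hm : ∑' i, m i = 1) (hm0 : ∀ i, hitSum A v z i = 0 → m i = 0)
    (hstat : ∀ j, m j =
      ∑' i, m i * doobTransform (fun i j => z * A i j) v (hitSum A v z) i j) (j : V) :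
    m j = tabooSum A v z j * hitSum A v z j / ∑' i, tabooSum A v z i * hitSum A v z i := by
  classical
  set h := hitSum A v z with hh
  set l := tabooSum A v z with hl
  set p := doobTransform (fun i j => z * A i j) v h with hp
  have hharm : ∀ i, h i = ∑' j, z * A i j * h j := hitSum_eq_of_eq_one A v z h1
  have hmul : ∀ i j, h i * p i j = z * A i j * h j := fun i j =>
    mul_doobTransform v hharm (hfin i) j
  have hmtop : ∀ i, m i ≠ ∞ := fun i => ENNReal.ne_top_of_tsum_ne_top (by rw [hm]; simp) i
  -- Iterated stationarity: `m` dominates `m v` times the contribution of excursions from `v` of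
  -- fewer than `n` steps.
  have hle : ∀ n j, m v * ∑ k ∈ Finset.range n, taboo A v k j * z ^ k * h j ≤ m j := by
    intro n
    induction n with
    | zero => simp
    | succ n ih =>
      intro j
      rw [Finset.sum_range_succ']
      by_cases hj : j = v
      · subst hj
        simp [taboo, h1]
      · have e : ∀ k, taboo A v (k + 1) j * z ^ (k + 1) * h j =
            ∑' i, taboo A v k i * z ^ k * h i * p i j := by
          intro k
          rw [taboo, if_neg hj, ← ENNReal.tsum_mul_right, ← ENNReal.tsum_mul_right]
          refine tsum_congr fun i => ?_
          rw [mul_assoc _ (h i), hmul]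
          ring
        simp only [taboo, if_neg hj, zero_mul, add_zero] at e ⊢
        simp_rw [e]
        rw [← Summable.tsum_finsetSum fun _ _ => ENNReal.summable, ← ENNReal.tsum_mul_left, hstat j]
        refine ENNReal.tsum_le_tsum fun i => ?_
        rw [← Finset.sum_mul, ← mul_assoc]
        exact mul_le_mul_left (ih i) _
  have hle' : ∀ j, m v * (l j * h j) ≤ m j := by
    intro j
    rw [hl, tabooSum, ← ENNReal.tsum_mul_right, ← ENNReal.tsum_mul_left]
    refine ENNReal.tsum_le_of_sum_range_le fun n => ?_
    rw [← Finset.mul_sum]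
    exact hle n j
  -- The excess `d` is again stationary and vanishes at `v`.
  choose d hd using fun j => le_iff_exists_add.mp (hle' j)
  have hstat' : ∀ j, l j * h j = ∑' i, l i * h i * p i j := by
    intro j
    rw [hl, tabooSum_eq_of_eq_one A v z h1 j, ← ENNReal.tsum_mul_right]
    refine tsum_congr fun i => ?_
    rw [mul_assoc _ (h i), hmul]
    ring
  have hdstat : ∀ j, d j = ∑' i, d i * p i j := by
    intro j
    have h2 : m v * (l j * h j) + d j = m v * (l j * h j) + ∑' i, d i * p i j := by
      rw [← hd j, hstat j, hstat' j, ← ENNReal.tsum_mul_left, ← ENNReal.tsum_add]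
      refine tsum_congr fun i => ?_
      rw [hd i]
      ring
    exact (ENNReal.add_right_inj (ne_top_of_le_ne_top (hmtop j) (hle' j))).mp h2
  have hdv : d v = 0 := by
    have h2 := hd v
    rw [hl, tabooSum_self, one_mul, h1, mul_one] at h2
    have h3 : m v + d v = m v + 0 := by rw [← h2, add_zero]
    exact (ENNReal.add_right_inj (hmtop v)).mp h3
  -- Zeros of a nonnegative stationary `d` spread backwards along edges, hence to every vertex from
  -- which `v` can be reached.
  have hstep : ∀ i j, A i j ≠ 0 → h j ≠ 0 → d j = 0 → d i = 0 := by
    intro i j hA hj hdj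
    have h2 := hdstat j
    rw [hdj, eq_comm, ENNReal.tsum_eq_zero] at h2
    rcases mul_eq_zero.mp (h2 i) with h3 | h3
    · exact h3
    · have h4 := hmul i j
      rw [h3, mul_zero, eq_comm] at h4
      simp [hz0, hA, hj] at h4
  have hd0 : ∀ n i, firstHit A v n i ≠ 0 → d i = 0 := by
    intro n
    induction n with
    | zero => exact fun i hi => hstep i v hi (by rw [h1]; simp) hdv
    | succ n ih =>
      intro i hi
      rw [firstHit, Ne, ENNReal.tsum_eq_zero, not_forall] at hi
      obtain ⟨j, hj⟩ := hi
      split_ifs at hj with hjv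
      · exact absurd rfl hj
      · have hj2 : firstHit A v n j ≠ 0 := right_ne_zero_of_mul hj
        refine hstep i j (left_ne_zero_of_mul hj) ?_ (ih j hj2)
        intro h0
        rw [hh, hitSum, ENNReal.tsum_eq_zero] at h0
        have := h0 n
        simp [hj2, hz0] at this
  have hmeq : ∀ i, m i = m v * (l i * h i) := by
    intro i
    by_cases h0 : h i = 0
    · rw [hm0 i h0, h0]
      simp
    · have h2 : ∃ n, firstHit A v n i ≠ 0 := by
        by_contra hcon
        push Not at hcon
        exact h0 (by simp [hh, hitSum, hcon])
      obtain ⟨n, hn⟩ := h2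
      rw [hd i, hd0 n i hn, add_zero]
  have hsum : m v * ∑' i, l i * h i = 1 := by
    rw [← ENNReal.tsum_mul_left, ← hm]
    exact tsum_congr fun i => (hmeq i).symm
  rw [hmeq j, mul_comm, div_eq_mul_inv, ENNReal.eq_inv_of_mul_eq_one_left hsum]

section

variable [MeasurableSpace V]

lemma exists_mem_pathSpace {G : Digraph V} {ν : ProbabilityMeasure (ℤ → V)}
    (hν : ν ∈ invariantMeasures G) {s : Set (ℤ → V)} (hs : (ν : Measure (ℤ → V)) s ≠ 0) :
    ∃ ω ∈ s, ω ∈ pathSpace G := by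
  by_contra hcon
  push Not at hcon
  apply hs
  rw [measure_eq_zero_iff_ae_notMem]
  filter_upwards [hν.2] with ω hω h
  exact hcon ω h hω

variable [DiscreteMeasurableSpace V] [Countable V]

lemma mem_invariantMeasures_of_cylinder {G : Digraph V} {μ : ProbabilityMeasure (ℤ → V)}
    (hμ : MeasurePreserving shift (μ : Measure (ℤ → V)) μ)
    (h : ∀ i j, ¬ G.Adj i j → (μ : Measure (ℤ → V)) (cylinder ![i, j]) = 0) :
    μ ∈ invariantMeasures G := by
  refine ⟨hμ, ?_⟩
  have h0 : ∀ᵐ ω ∂(μ : Measure (ℤ → V)), G.Adj (ω 0) (ω 1) := by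
    have h1 : ∀ q : V × V, ∀ᵐ ω ∂(μ : Measure (ℤ → V)),
        ω ∈ cylinder ![q.1, q.2] → G.Adj q.1 q.2 := by
      intro q
      by_cases hq : G.Adj q.1 q.2
      · exact ae_of_all _ fun _ _ => hq
      · have := measure_eq_zero_iff_ae_notMem.mp (h q.1 q.2 hq)
        filter_upwards [this] with ω hω h'
        exact absurd h' hω
    filter_upwards [ae_all_iff.mpr h1] with ω hω
    refine hω (ω 0, ω 1) fun i => ?_
    fin_cases i <;> rfl
  have h1 : ∀ i : ℤ, ∀ᵐ ω ∂(μ : Measure (ℤ → V)), G.Adj (ω i) (ω (i + 1)) := by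
    intro i
    filter_upwards [(measurePreserving_shiftBy hμ i).quasiMeasurePreserving.ae h0] with ω hω
    simpa [shiftBy, add_comm] using hω
  exact ae_all_iff.mpr h1

/-- The Markov measure of a recurrent loaded graph. -/
lemma exists_markov_of_hitSum {A : V → V → ℝ≥0∞} {v : V} {z : ℝ≥0∞}
    (h1 : hitSum A v z v = 1) (hfin : ∀ i, hitSum A v z i ≠ ∞)
    (hZ : ∑' i, tabooSum A v z i * hitSum A v z i ≠ ∞) :
    ∃ μ : ProbabilityMeasure (ℤ → V), MeasurePreserving shift (μ : Measure (ℤ → V)) μ ∧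
      ∀ (n : ℕ) (w : Fin (n + 1) → V), (μ : Measure (ℤ → V)) (cylinder w) =
        tabooSum A v z (w 0) * hitSum A v z (w 0) / (∑' i, tabooSum A v z i * hitSum A v z i) *
          ∏ i : Fin n, doobTransform (fun i j => z * A i j) v (hitSum A v z) (w i.castSucc)
            (w i.succ) := by
  classical
  set h := hitSum A v z with hh
  set l := tabooSum A v z with hl
  set Z := ∑' i, l i * h i with hZdef
  have hZ0 : Z ≠ 0 := by
    intro h0
    rw [hZdef, ENNReal.tsum_eq_zero] at h0
    have := h0 v
    rw [hl, tabooSum_self, h1] at this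
    simp at this
  have hharm : ∀ i, h i = ∑' j, z * A i j * h j := hitSum_eq_of_eq_one A v z h1
  have hlharm : ∀ j, l j = ∑' i, z * A i j * l i := by
    intro j
    rw [hl, tabooSum_eq_of_eq_one A v z h1 j]
    exact tsum_congr fun i => mul_comm _ _
  -- The reversed chain is the same transform of the transposed matrix, with `l` in the role of `h`.
  apply exists_markov_measure (fun i => l i * h i / Z)
    (doobTransform (fun i j => z * A i j) v h) (doobTransform (fun j i => z * A i j) v l)
  · simp_rw [div_eq_mul_inv]
    rw [ENNReal.tsum_mul_right]
    exact ENNReal.mul_inv_cancel hZ0 hZ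
  · exact tsum_doobTransform v hharm
  · exact tsum_doobTransform v hlharm
  · intro i j
    have e1 : l i * h i / Z * doobTransform (fun i j => z * A i j) v h i j =
        l i * (z * A i j * h j) / Z := by
      rw [← mul_doobTransform v hharm (hfin i) j]
      simp only [div_eq_mul_inv]
      ring
    have e2 : l j * h j * doobTransform (fun j i => z * A i j) v l j i =
        z * A i j * l i * h j := by
      by_cases hl0 : l j = ∞
      · have hj : h j = 0 := by
          by_contra h0
          refine hZ (top_le_iff.mp (le_trans ?_ (ENNReal.le_tsum j)))
          rw [hl0, ENNReal.top_mul h0]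
        simp [hj]
      · rw [← mul_doobTransform v hlharm hl0 i]
        ring
    rw [e1]
    calc _ = z * A i j * l i * h j / Z := by
          congr 1
          ring
      _ = _ := by
          rw [← e2]
          simp only [div_eq_mul_inv]
          ring

/-- A recurrent loaded graph with finite mean return time and bounded out-degrees has exactly one
equilibrium measure, namely the Markov measure given by the harmonic functions. -/
theorem exists_unique_equilibrium {G : Digraph V} {W : V → V → ℝ≥0} {v : V} {z : ℝ≥0∞}
    (hz0 : z ≠ 0) (hz : z ≠ ∞) (hW : ∀ i j, G.Adj i j → 0 < W i j)
    (h1 : genFun G W v z = 1) (hfin : ∀ i, hitSum (edgeWeight G W) v z i ≠ ∞)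
    (hpos : ∀ i j, G.Adj i j → hitSum (edgeWeight G W) v z i ≠ 0)
    (hD : genFunDeriv G W v z ≠ ∞)
    (hdeg : ∃ N : ℕ, ∀ i, ∃ F : Finset V, F.card ≤ N ∧ ∀ j, G.Adj i j → j ∈ F) :
    ∃ μ : ProbabilityMeasure (ℤ → V), IsEquilibriumMeasure G W μ ∧
      (∀ ν, IsEquilibriumMeasure G W ν → ν = μ) ∧
      ∀ (n : ℕ) (w : Fin (n + 1) → V), (μ : Measure (ℤ → V)) (cylinder w) =
        tabooSum (edgeWeight G W) v z (w 0) *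
          (∏ i : Fin n, z * edgeWeight G W (w i.castSucc) (w i.succ)) *
          hitSum (edgeWeight G W) v z (w (Fin.last n)) / (z * genFunDeriv G W v z) := by
  classical
  rw [genFun_eq] at h1
  set A := edgeWeight G W with hA
  set h := hitSum A v z with hh
  set l := tabooSum A v z with hl
  set p := doobTransform (fun i j => z * A i j) v h with hp
  have hZ : ∑' i, l i * h i = z * genFunDeriv G W v z := by
    rw [genFunDeriv_eq]
    exact tsum_tabooSum_mul_hitSum A v z
  have hZtop : ∑' i, l i * h i ≠ ∞ := by
    rw [hZ]
    exact ENNReal.mul_ne_top hz hD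
  have hharm : ∀ i, h i = ∑' j, z * A i j * h j := hitSum_eq_of_eq_one A v z h1
  have hp1 : ∀ i, ∑' j, p i j = 1 := tsum_doobTransform v hharm
  have hmul : ∀ i j, h i * p i j = z * A i j * h j := fun i j =>
    mul_doobTransform v hharm (hfin i) j
  obtain ⟨μ, hμ, hcyl⟩ : ∃ μ : ProbabilityMeasure (ℤ → V),
      MeasurePreserving shift (μ : Measure (ℤ → V)) μ ∧
      ∀ (n : ℕ) (w : Fin (n + 1) → V), (μ : Measure (ℤ → V)) (cylinder w) =
        l (w 0) * h (w 0) / (∑' i, l i * h i) * ∏ i : Fin n, p (w i.castSucc) (w i.succ) :=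
    exists_markov_of_hitSum h1 hfin hZtop
  have hμmarkov : ∀ (n : ℕ) (u : Fin (n + 2) → V), (μ : Measure (ℤ → V)) (cylinder u) =
      (μ : Measure (ℤ → V)) (cylinder (Fin.init u)) *
        p (u (Fin.last n).castSucc) (u (Fin.last (n + 1))) := by
    intro n u
    rw [hcyl, hcyl, Fin.prod_univ_castSucc, ← mul_assoc]
    rfl
  have hμ0 : ∀ i j, ¬ G.Adj i j → (μ : Measure (ℤ → V)) (cylinder ![i, j]) = 0 := by
    intro i j hij
    have h2 : z * A i j * h j = 0 := by simp [hA, edgeWeight, hij]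
    have h3 : (μ : Measure (ℤ → V)) (cylinder ![i, j]) =
        l i * h i / (∑' i, l i * h i) * p i j := by
      rw [hcyl]
      simp
    rw [h3]
    calc _ = l i * (h i * p i j) / (∑' i, l i * h i) := by
          simp only [div_eq_mul_inv]
          ring
      _ = 0 := by rw [hmul, h2]; simp
  have hμinv : μ ∈ invariantMeasures G := mem_invariantMeasures_of_cylinder hμ hμ0
  have hpne : ∀ ω ∈ pathSpace G, ∀ i : ℤ, p (ω i) (ω (i + 1)) ≠ 0 := by
    intro ω hω i h0
    have h2 := hmul (ω i) (ω (i + 1))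
    rw [h0, mul_zero, eq_comm] at h2
    have h3 : A (ω i) (ω (i + 1)) ≠ 0 := by
      simp only [hA, edgeWeight, if_pos (hω i)]
      exact_mod_cast (hW _ _ (hω i)).ne'
    simp [hz0, h3, hpos _ _ (hω (i + 1))] at h2
  have hsupp : ∀ ν ∈ invariantMeasures G, ∀ (n : ℕ) (u : Fin (n + 2) → V),
      (ν : Measure (ℤ → V)) (cylinder u) ≠ 0 →
        p (u (Fin.last n).castSucc) (u (Fin.last (n + 1))) ≠ 0 := by
    intro ν hν n u hu
    obtain ⟨ω, hω, hω'⟩ := exists_mem_pathSpace hν hu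
    have h2 := hpne ω hω' n
    have e1 := hω (Fin.last n).castSucc
    have e2 := hω (Fin.last (n + 1))
    simp only [Fin.val_castSucc, Fin.val_last] at e1 e2
    rw [← e1, ← e2]
    exact_mod_cast h2
  -- Taking logarithms in `hmul` shows that log W is cohomologous to `log p - log z`, with transfer
  -- function log h.
  have hlog : ∀ ν ∈ invariantMeasures G, ∀ᵐ ω ∂(ν : Measure (ℤ → V)),
      Real.log (W (ω 0) (ω 1)) = -Real.log z.toReal - surprisal p (ω 0) (ω 1) +
        Real.log (h (ω 0)).toReal - Real.log (h (ω 1)).toReal := by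
    intro ν hν
    filter_upwards [hν.2] with ω hω
    have a0 := hω 0
    have a1 := hω 1
    rw [zero_add] at a0
    have hw := hW _ _ a0
    have e := congrArg ENNReal.toReal (hmul (ω 0) (ω 1))
    simp only [ENNReal.toReal_mul, hA, edgeWeight, if_pos a0, ENNReal.coe_toReal] at e
    have t0 : (h (ω 0)).toReal ≠ 0 := ENNReal.toReal_ne_zero.mpr ⟨hpos _ _ a0, hfin _⟩
    have t1 : (h (ω 1)).toReal ≠ 0 := ENNReal.toReal_ne_zero.mpr ⟨hpos _ _ a1, hfin _⟩
    have t2 : (p (ω 0) (ω 1)).toReal ≠ 0 :=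
      ENNReal.toReal_ne_zero.mpr ⟨by simpa using hpne ω hω 0, prob_ne_top hp1 _ _⟩
    have t3 : z.toReal ≠ 0 := ENNReal.toReal_ne_zero.mpr ⟨hz0, hz⟩
    have t4 : (W (ω 0) (ω 1) : ℝ) ≠ 0 := by exact_mod_cast hw.ne'
    have e2 := congrArg Real.log e
    rw [Real.log_mul t0 t2, Real.log_mul (mul_ne_zero t3 t4) t1, Real.log_mul t3 t4] at e2
    rw [surprisal]
    linarith
  -- As `-t log t ≤ 1` for a probability `t`, each vertex contributes at most `N` times its
  -- stationary probability.
  have hEμ : crossEntropy p (μ : Measure (ℤ → V)) ≠ ∞ := by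
    obtain ⟨N, hN⟩ := hdeg
    rw [crossEntropy_eq_tsum hμ 0, ← (finTwoArrowEquiv V).symm.tsum_eq, ENNReal.tsum_prod']
    have hterm : ∀ i, ∑' j, ENNReal.ofReal (surprisal p i j) *
        (μ : Measure (ℤ → V)) (cylinder ![i, j]) ≤ l i * h i / (∑' i, l i * h i) * N := by
      intro i
      obtain ⟨F, hF, hF'⟩ := hN i
      rw [tsum_eq_sum (s := F)]
      swap
      · intro j hj
        rw [hμ0 i j fun hij => hj (hF' j hij), mul_zero]
      calc _ ≤ ∑ j ∈ F, l i * h i / (∑' i, l i * h i) := by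
            refine Finset.sum_le_sum fun j _ => ?_
            have h3 : (μ : Measure (ℤ → V)) (cylinder ![i, j]) =
                l i * h i / (∑' i, l i * h i) * p i j := by
              rw [hcyl]
              simp
            rw [h3, mul_left_comm]
            refine mul_le_of_le_one_right (zero_le) ?_
            rw [← ENNReal.ofReal_toReal (prob_ne_top hp1 i j),
              ← ENNReal.ofReal_mul (surprisal_nonneg hp1 i j), ENNReal.ofReal_le_one, surprisal]
            rcases (ENNReal.toReal_nonneg (a := p i j)).eq_or_lt with h0 | h0
            · rw [← h0]
              simp
            · have h4 := mul_le_mul_of_nonneg_right (Real.one_sub_inv_le_log_of_pos h0) h0.le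
              have h5 : (1 - (p i j).toReal⁻¹) * (p i j).toReal = (p i j).toReal - 1 := by
                field_simp
              rw [h5] at h4
              linarith
        _ = F.card * (l i * h i / (∑' i, l i * h i)) := by simp
        _ ≤ _ := by
            rw [mul_comm]
            gcongr
    refine ne_top_of_le_ne_top ?_ (ENNReal.tsum_le_tsum hterm)
    simp_rw [div_eq_mul_inv]
    rw [ENNReal.tsum_mul_right, ENNReal.tsum_mul_right]
    refine ENNReal.mul_ne_top (ne_top_of_le_ne_top ENNReal.one_ne_top ?_) (by simp)
    rw [← div_eq_mul_inv]
    exact ENNReal.div_self_le_one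
  have hle : ∀ ν ∈ invariantMeasures G,
      entropy (ν : Measure (ℤ → V)) ≤ crossEntropy p (ν : Measure (ℤ → V)) := fun ν hν =>
    (iInf_le _ 1).trans (condEntropy_le_crossEntropy hν.1 hp1 0 (hsupp ν hν 0)).1
  -- If the cross entropy is finite, the free energy falls short of `-log z` by cross entropy minus
  -- entropy, so attaining the bound forces the two to agree.
  have hbound : ∀ ν ∈ invariantMeasures G,
      freeEnergy W (ν : Measure (ℤ → V)) ≤ ((-Real.log z.toReal : ℝ) : EReal) ∧
      (((-Real.log z.toReal : ℝ) : EReal) ≤ freeEnergy W (ν : Measure (ℤ → V)) →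
        crossEntropy p (ν : Measure (ℤ → V)) ≠ ∞ ∧
        crossEntropy p (ν : Measure (ℤ → V)) ≤ entropy (ν : Measure (ℤ → V))) := by
    intro ν hν
    have hf := freeEnergy_eq (κ := fun i => Real.log (h i).toReal) hν.1 hp1 (hlog ν hν)
    by_cases hE : crossEntropy p (ν : Measure (ℤ → V)) = ∞
    · rw [hf.1 hE]
      exact ⟨bot_le, fun hcon => absurd (le_bot_iff.mp hcon) (EReal.coe_ne_bot _)⟩
    · rw [hf.2 hE]
      have hS : entropy (ν : Measure (ℤ → V)) ≠ ∞ := ne_top_of_le_ne_top hE (hle ν hν)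
      have hS' : ((entropy (ν : Measure (ℤ → V)) : ℝ≥0∞) : EReal) =
          ((entropy (ν : Measure (ℤ → V))).toReal : EReal) :=
        (EReal.coe_ennreal_toReal hS).symm
      rw [hS', ← EReal.coe_add, EReal.coe_le_coe_iff, EReal.coe_le_coe_iff]
      constructor
      · have := ENNReal.toReal_mono hE (hle ν hν)
        linarith
      · intro hcon
        exact ⟨hE, (ENNReal.toReal_le_toReal hE hS).mp (by linarith)⟩
  have hμfree : freeEnergy W (μ : Measure (ℤ → V)) = ((-Real.log z.toReal : ℝ) : EReal) := by
    rw [(freeEnergy_eq (κ := fun i => Real.log (h i).toReal) hμ hp1 (hlog μ hμinv)).2 hEμ,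
      entropy_eq_crossEntropy_of_markov hμ hμmarkov, ← EReal.coe_ennreal_toReal hEμ,
      ← EReal.coe_add]
    congr 1
    ring
  refine ⟨μ, ⟨hμinv, fun ν hν => (hbound ν hν).1.trans_eq hμfree.symm⟩, ?_, ?_⟩
  · intro ν hν
    obtain ⟨hνinv, hνmax⟩ := hν
    obtain ⟨hE, hEle⟩ := (hbound ν hνinv).2 (hμfree.symm.le.trans (hνmax μ hμinv))
    -- The entropy is an infimum, so equality with it gives equality in Gibbs' inequality for every
    -- word length.
    have hmarkov : ∀ (n : ℕ) (u : Fin (n + 2) → V), (ν : Measure (ℤ → V)) (cylinder u) =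
        (ν : Measure (ℤ → V)) (cylinder (Fin.init u)) *
          p (u (Fin.last n).castSucc) (u (Fin.last (n + 1))) := fun n =>
      (condEntropy_le_crossEntropy hνinv.1 hp1 n (hsupp ν hνinv n)).2 hE
        (hEle.trans (iInf_le _ _))
    have hmarg : ∀ j, (ν : Measure (ℤ → V)) (cylinder ![j]) =
        l j * h j / ∑' i, l i * h i := by
      apply stationary_unique hz0 h1 hfin
      · rw [← tsum_cylinder (ν := (ν : Measure (ℤ → V))) 1,
          ← (Equiv.funUnique (Fin 1) V).symm.tsum_eq]
        refine tsum_congr fun a => ?_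
        congr 2
        funext k
        simp
      · intro i hi
        by_contra h0
        obtain ⟨ω, hω, hω'⟩ := exists_mem_pathSpace hνinv h0
        have e : ω 0 = i := hω 0
        exact hpos _ _ (hω' 0) (by rw [e]; exact hi)
      · intro j
        have e : ∀ i, (ν : Measure (ℤ → V)) (cylinder ![i]) * p i j =
            (ν : Measure (ℤ → V)) (cylinder ![i, j]) := by
          intro i
          rw [hmarkov 0 ![i, j]]
          have e' : (Fin.init ![i, j] : Fin 1 → V) = ![i] := by
            funext k
            fin_cases k
            rfl
          rw [e']
          rfl
        refine Eq.trans ?_ (tsum_congr e).symm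
        rw [← (measurePreserving_shiftBy hνinv.1 1).measure_preimage
          (measurableSet_cylinder ![j]).nullMeasurableSet, ← measure_iUnion]
        · congr 1
          ext ω
          simp [cylinder, shiftBy, Fin.forall_fin_two]
        · intro a b hab
          rw [Function.onFun, Set.disjoint_left]
          intro ω ha hb
          exact hab ((ha 0).symm.trans (hb 0))
        · exact fun i => measurableSet_cylinder _
    apply ProbabilityMeasure.toMeasure_injective
    apply ext_of_cylinder hνinv.1 hμ
    intro n
    induction n with
    | zero =>
      intro w
      have e : w = ![w 0] := by
        funext k
        fin_cases k
        rfl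
      rw [hcyl]
      conv_lhs => rw [e, hmarg]
      simp
    | succ n ih =>
      intro w
      rw [hmarkov, hμmarkov, ih]
  · intro n w
    rw [hcyl, ← hZ]
    -- The factors `h` telescope along the word.
    have key : ∀ (n : ℕ) (w : Fin (n + 1) → V),
        h (w 0) * ∏ i : Fin n, p (w i.castSucc) (w i.succ) =
        (∏ i : Fin n, z * A (w i.castSucc) (w i.succ)) * h (w (Fin.last n)) := by
      intro n
      induction n with
      | zero => intro w; simp
      | succ n ih =>
        intro w
        rw [Fin.prod_univ_succ, Fin.prod_univ_succ, ← mul_assoc]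
        have e := ih (Fin.tail w)
        simp only [Fin.tail] at e
        calc _ = z * A (w 0) (w 1) * (h (w 1) *
              ∏ i : Fin n, p (w i.castSucc.succ) (w i.succ.succ)) := by
              rw [← mul_assoc, ← hmul]
              rfl
          _ = _ := by
              rw [mul_assoc (z * A _ _), ← Fin.succ_last]
              exact congrArg _ e
    have e := key n w
    calc _ = l (w 0) * (h (w 0) * ∏ i : Fin n, p (w i.castSucc) (w i.succ)) /
          (∑' i, l i * h i) := by
          simp only [div_eq_mul_inv]
          ring
      _ = _ := by rw [e, mul_assoc]

end

end Equilibrium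


/-! ### Change of the base vertex -/

section Solidarity

variable {V : Type*}

open Classical in
/-- The weight matrix without the edges that end at `b`. -/
def avoiding (A : V → V → ℝ≥0∞) (b : V) (i j : V) : ℝ≥0∞ := if j = b then 0 else A i j

/-- The derivative, multiplied by the variable, of the generating function of the first passage
sums. -/
def hitDeriv (A : V → V → ℝ≥0∞) (v : V) (z : ℝ≥0∞) (i : V) : ℝ≥0∞ :=
  ∑' n : ℕ, ((n + 1 : ℕ) : ℝ≥0∞) * (firstHit A v n i * z ^ (n + 1))

lemma hitDeriv_eq (G : Digraph V) (W : V → V → ℝ≥0) (v : V) (z : ℝ≥0∞) :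
    hitDeriv (edgeWeight G W) v z v = z * genFunDeriv G W v z := by
  rw [genFunDeriv_eq, hitDeriv, ← ENNReal.tsum_mul_left]
  refine tsum_congr fun n => ?_
  ring

/-- Decomposition of the paths from `i` to `a` at the first passage through `b`. -/
lemma firstHit_eq_add (A : V → V → ℝ≥0∞) {a b : V} (hab : a ≠ b) (n : ℕ) (i : V) :
    firstHit A a n i = firstHit (avoiding A b) a n i +
      ∑ k ∈ Finset.range n, firstHit (avoiding A a) b k i * firstHit A a (n - 1 - k) b := by
  classical
  induction n generalizing i with
  | zero => simp [firstHit, avoiding, hab]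
  | succ n ih =>
    rw [Finset.sum_range_succ']
    have e1 : ∀ k ∈ Finset.range n,
        firstHit (avoiding A a) b (k + 1) i * firstHit A a (n + 1 - 1 - (k + 1)) b =
        ∑' j, if j = a ∨ j = b then 0 else
          A i j * (firstHit (avoiding A a) b k j * firstHit A a (n - 1 - k) b) := by
      intro k _
      rw [firstHit, ← ENNReal.tsum_mul_right, show n + 1 - 1 - (k + 1) = n - 1 - k by omega]
      refine tsum_congr fun j => ?_
      by_cases h1 : j = a <;> by_cases h2 : j = b <;> simp [h1, h2, avoiding, mul_assoc]
    rw [Finset.sum_congr rfl e1, ← Summable.tsum_finsetSum fun _ _ => ENNReal.summable]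
    have e2 : firstHit (avoiding A b) a (n + 1) i =
        ∑' j, if j = a ∨ j = b then 0 else A i j * firstHit (avoiding A b) a n j := by
      rw [firstHit]
      refine tsum_congr fun j => ?_
      by_cases h1 : j = a <;> by_cases h2 : j = b <;> simp [h1, h2, avoiding]
    rw [e2, ← add_assoc, ← ENNReal.tsum_add]
    have e3 : ∀ j, ((if j = a ∨ j = b then 0 else A i j * firstHit (avoiding A b) a n j) +
        ∑ k ∈ Finset.range n, if j = a ∨ j = b then 0 else
          A i j * (firstHit (avoiding A a) b k j * firstHit A a (n - 1 - k) b)) =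
        if j = b then 0 else if j = a then 0 else A i j * firstHit A a n j := by
      intro j
      by_cases h1 : j = a
      · simp [h1]
      · by_cases h2 : j = b
        · simp [h2]
        · simp only [h1, h2, or_self, if_false]
          rw [ih j, mul_add, Finset.mul_sum]
    have e4 : firstHit A a (n + 1) i = ∑' j, if j = a then 0 else A i j * firstHit A a n j := by
      rw [firstHit]
    -- The term `j = b`, where the first step already reaches `b`, is the summand `k = 0` of the
    -- decomposition.
    rw [tsum_congr e3, e4,
      ENNReal.tsum_eq_add_tsum_ite (f := fun j => if j = a then 0 else A i j * firstHit A a n j) b,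
      add_comm]
    congr 1
    simp [firstHit, avoiding, hab.symm]

lemma tsum_mul_sum_range (w s y : ℕ → ℝ≥0∞) :
    ∑' n, w n * ∑ k ∈ Finset.range n, s k * y (n - 1 - k) =
      ∑' (k : ℕ) (m : ℕ), w (k + m + 1) * (s k * y m) := by
  rw [tsum_eq_zero_add' ENNReal.summable, tsum_nat_nat_antidiagonal fun k m =>
    w (k + m + 1) * (s k * y m)]
  simp only [Finset.range_zero, Finset.sum_empty, mul_zero, zero_add]
  refine tsum_congr fun n => ?_
  rw [Finset.mul_sum, Finset.Nat.sum_antidiagonal_eq_sum_range_succ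
    fun k m => w (k + m + 1) * (s k * y m)]
  refine Finset.sum_congr rfl fun k hk => ?_
  have := Finset.mem_range.mp hk
  rw [show k + (n - k) + 1 = n + 1 by omega, show n + 1 - 1 - k = n - k by omega]

lemma hitSum_eq_add (A : V → V → ℝ≥0∞) {a b : V} (hab : a ≠ b) (z : ℝ≥0∞) (i : V) :
    hitSum A a z i = hitSum (avoiding A b) a z i +
      hitSum (avoiding A a) b z i * hitSum A a z b := by
  have h : ∀ n, firstHit A a n i * z ^ (n + 1) = firstHit (avoiding A b) a n i * z ^ (n + 1) +
      z ^ (n + 1) * ∑ k ∈ Finset.range n,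
        firstHit (avoiding A a) b k i * firstHit A a (n - 1 - k) b := by
    intro n
    rw [firstHit_eq_add A hab]
    ring
  rw [hitSum, tsum_congr h, ENNReal.tsum_add, tsum_mul_sum_range (fun n => z ^ (n + 1))
    (fun k => firstHit (avoiding A a) b k i) (fun m => firstHit A a m b)]
  congr 1
  rw [hitSum, ← ENNReal.tsum_mul_right]
  refine tsum_congr fun k => ?_
  rw [hitSum, ← ENNReal.tsum_mul_left]
  refine tsum_congr fun m => ?_
  ring

/-- The product rule for the first passage decomposition: the length of a path through `b` is the
sum of the lengths of its two parts. -/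
lemma hitDeriv_eq_add (A : V → V → ℝ≥0∞) {a b : V} (hab : a ≠ b) (z : ℝ≥0∞) (i : V) :
    hitDeriv A a z i = hitDeriv (avoiding A b) a z i +
      (hitDeriv (avoiding A a) b z i * hitSum A a z b +
        hitSum (avoiding A a) b z i * hitDeriv A a z b) := by
  have h : ∀ n : ℕ, ((n + 1 : ℕ) : ℝ≥0∞) * (firstHit A a n i * z ^ (n + 1)) =
      ((n + 1 : ℕ) : ℝ≥0∞) * (firstHit (avoiding A b) a n i * z ^ (n + 1)) +
      ((n + 1 : ℕ) : ℝ≥0∞) * z ^ (n + 1) * ∑ k ∈ Finset.range n,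
        firstHit (avoiding A a) b k i * firstHit A a (n - 1 - k) b := by
    intro n
    rw [firstHit_eq_add A hab]
    ring
  rw [hitDeriv, tsum_congr h, ENNReal.tsum_add, tsum_mul_sum_range
    (fun n => ((n + 1 : ℕ) : ℝ≥0∞) * z ^ (n + 1))
    (fun k => firstHit (avoiding A a) b k i) (fun m => firstHit A a m b)]
  congr 1
  rw [hitDeriv, ← ENNReal.tsum_mul_right, hitSum.eq_def (avoiding A a), ← ENNReal.tsum_mul_right,
    ← ENNReal.tsum_add]
  refine tsum_congr fun k => ?_
  rw [hitSum, hitDeriv, ← ENNReal.tsum_mul_left, ← ENNReal.tsum_mul_left, ← ENNReal.tsum_add]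
  refine tsum_congr fun m => ?_
  push_cast
  ring

/-- A bound for the first passage sums from `b` that is summed over the returns to `b`. -/
lemma hitSum_le_div (A : V → V → ℝ≥0∞) {a b : V} (hab : a ≠ b) {z : ℝ≥0∞}
    (hfin : ∀ n, firstHit A a n b * z ^ (n + 1) ≠ ∞)
    (hlt : hitSum (avoiding A a) b z b < 1) :
    hitSum A a z b ≤
      hitSum (avoiding A b) a z b / (1 - hitSum (avoiding A a) b z b) := by
  classical
  rw [hitSum]
  refine ENNReal.tsum_le_of_sum_range_le fun N => ?_
  set S := ∑ n ∈ Finset.range N, firstHit A a n b * z ^ (n + 1) with hS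
  have hStop : S ≠ ∞ := ENNReal.sum_ne_top.mpr fun n _ => hfin n
  -- Truncation closes the renewal inequality on the finite partial sum `S`, from which a multiple
  -- of `S` may be subtracted.
  let y : ℕ → ℝ≥0∞ := fun n => if n < N then firstHit A a n b else 0
  have hSy : S = ∑' m, y m * z ^ (m + 1) := by
    rw [hS, tsum_eq_sum (s := Finset.range N)]
    · refine Finset.sum_congr rfl fun n hn => ?_
      simp only [y, if_pos (Finset.mem_range.mp hn)]
    · intro n hn
      simp only [y, if_neg fun h => hn (Finset.mem_range.mpr h), zero_mul]
  have hle : S ≤ hitSum (avoiding A b) a z b + hitSum (avoiding A a) b z b * S := by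
    have h : ∀ n ∈ Finset.range N, firstHit A a n b * z ^ (n + 1) =
        firstHit (avoiding A b) a n b * z ^ (n + 1) +
        z ^ (n + 1) * ∑ k ∈ Finset.range n, firstHit (avoiding A a) b k b * y (n - 1 - k) := by
      intro n hn
      have hn' := Finset.mem_range.mp hn
      rw [firstHit_eq_add A hab, add_mul, mul_comm (Finset.sum _ _)]
      congr 2
      refine Finset.sum_congr rfl fun k _ => ?_
      simp only [y]
      rw [if_pos (by omega)]
    have hS' := hS.trans (Finset.sum_congr rfl h)
    rw [Finset.sum_add_distrib] at hS'
    refine hS'.le.trans ?_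
    refine add_le_add (ENNReal.sum_le_tsum _) ?_
    refine (ENNReal.sum_le_tsum _).trans ?_
    rw [tsum_mul_sum_range (fun n => z ^ (n + 1)) (fun k => firstHit (avoiding A a) b k b) y,
      hSy, hitSum, ← ENNReal.tsum_mul_right]
    refine ENNReal.tsum_le_tsum fun k => ?_
    rw [← ENNReal.tsum_mul_left]
    refine ENNReal.tsum_le_tsum fun m => le_of_eq ?_
    ring
  set α := hitSum (avoiding A a) b z b
  have h1 : 1 - α ≠ 0 := (tsub_pos_of_lt hlt).ne'
  rw [ENNReal.le_div_iff_mul_le (Or.inl h1) (Or.inl (by simp)),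
    ENNReal.mul_sub (fun _ _ => hStop), mul_one, tsub_le_iff_right, mul_comm S]
  exact hle

lemma hitSum_convex (A : V → V → ℝ≥0∞) (v i : V) (w₁ w₂ : ℝ≥0∞) (hw : w₁ + w₂ = 1)
    (x y : ℝ≥0∞) :
    hitSum A v (w₁ * x + w₂ * y) i ≤ w₁ * hitSum A v x i + w₂ * hitSum A v y i := by
  rw [hitSum, hitSum, hitSum, ← ENNReal.tsum_mul_left, ← ENNReal.tsum_mul_left, ← ENNReal.tsum_add]
  refine ENNReal.tsum_le_tsum fun n => ?_
  have h := ENNReal.rpow_arith_mean_le_arith_mean2_rpow w₁ w₂ x y hw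
    (p := ((n + 1 : ℕ) : ℝ)) (by simp)
  simp only [ENNReal.rpow_natCast] at h
  calc _ ≤ firstHit A v n i * (w₁ * x ^ (n + 1) + w₂ * y ^ (n + 1)) := by gcongr
    _ = _ := by ring

lemma hitSum_mono (A : V → V → ℝ≥0∞) (v i : V) {x y : ℝ≥0∞} (h : x ≤ y) :
    hitSum A v x i ≤ hitSum A v y i :=
  ENNReal.tsum_le_tsum fun n => by gcongr

lemma ne_zero_and_ne_top_of_hitSum_eq_one {A : V → V → ℝ≥0∞} {v : V} {z : ℝ≥0∞}
    (h : hitSum A v z v = 1) : z ≠ 0 ∧ z ≠ ∞ := by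
  constructor
  · rintro rfl
    simp [hitSum] at h
  · rintro rfl
    by_cases h0 : ∀ n, firstHit A v n v = 0
    · simp [hitSum, h0] at h
    · push Not at h0
      obtain ⟨n, hn⟩ := h0
      have h1 := ENNReal.le_tsum (f := fun n => firstHit A v n v * ∞ ^ (n + 1)) n
      rw [← hitSum, h] at h1
      simp [hn] at h1

end Solidarity

/-! ### Unstable positivity at the vertex 1 -/

section

variable {G : Digraph ℕ+} {W : ℕ+ → ℕ+ → ℝ≥0}

lemma IsLinear.lt_of_adj (hlin : IsLinear G) {i j : ℕ+} (h : G.Adj i j) (hj : j ≠ 1) : i < j := by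
  rcases hlin.edge i j h with h | h | h
  · exact absurd h hj
  · rw [h]
    exact PNat.lt_add_right i 1
  · exact (PNat.lt_add_right i 1).trans h

/-- Edges that do not end at 1 ascend, so without them no vertex at or below the start can be
reached. -/
lemma firstHit_avoiding_one_eq_zero (hlin : IsLinear G) {v i : ℕ+} (hi : v ≤ i) (n : ℕ) :
    firstHit (avoiding (edgeWeight G W) 1) v n i = 0 := by
  have h0 : ∀ i j, j ≤ i → avoiding (edgeWeight G W) 1 i j = 0 := by
    intro i j hji
    rw [avoiding]
    split_ifs with hj
    · rfl
    · rw [edgeWeight, if_neg fun h => absurd (hlin.lt_of_adj h hj) (not_lt.mpr hji)]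
  induction n generalizing i with
  | zero => exact h0 _ _ hi
  | succ n ih =>
    rw [firstHit, ENNReal.tsum_eq_zero]
    intro j
    split_ifs
    · rfl
    · rcases le_or_gt j i with hj | hj
      · rw [h0 _ _ hj, zero_mul]
      · rw [ih (hi.trans hj.le), mul_zero]

/-- In a linear graph, the properties that define unstable positivity do not depend on the
vertex. -/
theorem unstable_positive_at_one (hlin : IsLinear G) (hW : ∀ i j, G.Adj i j → 0 < W i j)
    (hup : IsUnstablePositive G W) :
    genFun G W 1 (radius G W 1) = 1 ∧ genFunDeriv G W 1 (radius G W 1) < ∞ := by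
  obtain ⟨v, hv, hv'⟩ := hup
  by_cases hv1 : v = 1
  · subst hv1
    exact ⟨hv, hv'⟩
  set ρ := radius G W v with hρ
  set A := edgeWeight G W with hA
  rw [genFun_eq] at hv
  obtain ⟨hρ0, hρtop⟩ := ne_zero_and_ne_top_of_hitSum_eq_one hv
  -- With f for passages from 1 to `v`, g for those from `v` to 1 and a for simple 1-cycles off `v`,
  -- the identities below read Φ_v = g y, y = f + a y and Φ_1 = a + f g.
  have hs : ∀ z, hitSum (avoiding A 1) v z v = 0 := fun z => by
    simp [hitSum, hA, firstHit_avoiding_one_eq_zero hlin le_rfl]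
  have hs' : ∀ z, hitDeriv (avoiding A 1) v z v = 0 := fun z => by
    simp [hitDeriv, hA, firstHit_avoiding_one_eq_zero hlin le_rfl]
  have yv : ∀ z, hitSum A v z v = hitSum (avoiding A v) 1 z v * hitSum A v z 1 := fun z => by
    rw [hitSum_eq_add A hv1, hs, zero_add]
  have uv : ∀ z, hitSum A 1 z v = hitSum (avoiding A v) 1 z v := fun z => by
    rw [hitSum_eq_add A (Ne.symm hv1), hs, zero_mul, add_zero]
  have y1 : ∀ z, hitSum A v z 1 = hitSum (avoiding A 1) v z 1 +
      hitSum (avoiding A v) 1 z 1 * hitSum A v z 1 := fun z => hitSum_eq_add A hv1 z 1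
  have u1 : ∀ z, hitSum A 1 z 1 = hitSum (avoiding A v) 1 z 1 +
      hitSum (avoiding A 1) v z 1 * hitSum (avoiding A v) 1 z v := fun z => by
    rw [hitSum_eq_add A (Ne.symm hv1), uv]
  have hg0 : ∀ z, z ≠ 0 → hitSum (avoiding A v) 1 z v ≠ 0 := by
    intro z hz h0
    rw [hitSum, ENNReal.tsum_eq_zero] at h0
    have h1 := h0 0
    have h2 : avoiding A v v 1 ≠ 0 := by
      rw [avoiding, if_neg (Ne.symm hv1), hA, edgeWeight, if_pos (hlin.backward v)]
      exact_mod_cast (hW _ _ (hlin.backward v)).ne'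
    simp [firstHit, hz, h2] at h1
  have hf0 : ∀ z, z ≠ 0 → hitSum (avoiding A 1) v z 1 ≠ 0 := by
    intro z hz h0
    rw [hitSum, ENNReal.tsum_eq_zero] at h0
    have h1 : ∀ n, firstHit A v n 1 = 0 := by
      intro n
      induction n using Nat.strong_induction_on with
      | _ n ih =>
        rw [firstHit_eq_add A hv1]
        have h2 : firstHit (avoiding A 1) v n 1 = 0 := by simpa [hz] using h0 n
        rw [h2, zero_add]
        refine Finset.sum_eq_zero fun k hk => ?_
        have := Finset.mem_range.mp hk
        rw [ih _ (by omega), mul_zero]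
    have h2 := yv ρ
    rw [hv] at h2
    simp [hitSum, h1] at h2
  set g := hitSum (avoiding A v) 1 ρ v with hg
  set f := hitSum (avoiding A 1) v ρ 1 with hf
  set a := hitSum (avoiding A v) 1 ρ 1 with ha
  set y := hitSum A v ρ 1 with hy
  have hgy : g * y = 1 := by rw [← yv, hv]
  have hy0 : y ≠ 0 := right_ne_zero_of_mul (by rw [hgy]; simp)
  have hytop : y ≠ ∞ := by
    intro h
    rw [h, ENNReal.mul_top (hg0 ρ hρ0)] at hgy
    simp at hgy
  have hone : hitSum A 1 ρ 1 = 1 := by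
    rw [u1]
    have h := y1 ρ
    rw [← hy, ← hf, ← ha] at h
    calc a + f * g = a * (g * y) + f * g := by rw [hgy, mul_one]
      _ = g * (f + a * y) := by ring
      _ = 1 := by rw [← h, hgy]
  -- The derivatives of f, g and a occur with nonzero factors in the finite derivative of Φ_v, so
  -- each of them is finite.
  have hDone : hitDeriv A 1 ρ 1 ≠ ∞ := by
    have hDv : hitDeriv A v ρ v ≠ ∞ := by
      rw [hA, hitDeriv_eq]
      exact ENNReal.mul_ne_top hρtop hv'.ne
    rw [hitDeriv_eq_add A hv1, hs', zero_add] at hDv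
    obtain ⟨d1, d2⟩ := ENNReal.add_ne_top.mp hDv
    have hDg : hitDeriv (avoiding A v) 1 ρ v ≠ ∞ := fun h => d1 (by rw [h, ENNReal.top_mul hy0])
    have hDy : hitDeriv A v ρ 1 ≠ ∞ := fun h => d2 (by rw [h, ENNReal.mul_top (hg0 ρ hρ0)])
    rw [hitDeriv_eq_add A hv1] at hDy
    obtain ⟨d3, d4⟩ := ENNReal.add_ne_top.mp hDy
    have hDa : hitDeriv (avoiding A v) 1 ρ 1 ≠ ∞ := fun h =>
      (ENNReal.add_ne_top.mp d4).1 (by rw [h, ENNReal.top_mul hy0])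
    rw [hitDeriv_eq_add A (Ne.symm hv1)]
    have hfg : f * g ≠ ∞ := ne_top_of_le_ne_top ENNReal.one_ne_top
      (hone ▸ (u1 ρ ▸ le_add_self))
    refine ENNReal.add_ne_top.mpr ⟨hDa, ENNReal.add_ne_top.mpr ⟨?_, ?_⟩⟩
    · refine ENNReal.mul_ne_top d3 ?_
      rw [uv]
      exact fun h => hfg (by rw [hg, h, ENNReal.mul_top (hf0 ρ hρ0)])
    · refine ENNReal.mul_ne_top (fun h => hfg ?_) ?_
      · rw [hf, h, ENNReal.top_mul (hg0 ρ hρ0)]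
      · rw [hitDeriv_eq_add A (Ne.symm hv1), hs', hs, zero_mul, zero_mul, add_zero, add_zero]
        exact hDg
  -- If Φ_1 were finite at some `z > ρ`, so would be f, g and a. As `f g > 0`, `a(ρ) < 1`, and
  -- convexity keeps a below 1 at a point `x` slightly beyond `ρ`. There Φ_v is at most g f / (1 -
  -- a), which is finite, against the choice of `ρ`.
  have hrad : radius G W 1 = ρ := by
    apply le_antisymm
    · refine sSup_le fun z hz => ?_
      by_contra hlt
      push Not at hlt
      change genFun G W 1 z < ∞ at hz
      rw [genFun_eq, ← hA, u1] at hz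
      have hz0 : z ≠ 0 := (zero_le.trans_lt hlt).ne'
      obtain ⟨b1, b2⟩ := ENNReal.add_lt_top.mp hz
      have bf : hitSum (avoiding A 1) v z 1 ≠ ∞ := fun h =>
        b2.ne (by rw [h, ENNReal.top_mul (hg0 z hz0)])
      have bg : hitSum (avoiding A v) 1 z v ≠ ∞ := fun h =>
        b2.ne (by rw [h, ENNReal.mul_top (hf0 z hz0)])
      have ha1 : a < 1 := by
        rw [← hone, u1]
        refine ENNReal.lt_add_right (ne_top_of_le_ne_top ENNReal.one_ne_top ?_)
          (mul_ne_zero (hf0 ρ hρ0) (hg0 ρ hρ0))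
        rw [← hone, u1]
        exact le_self_add
      obtain ⟨θ, hθ0, hθ1, hθ⟩ : ∃ θ : ℝ≥0∞, θ ≠ 0 ∧ θ ≤ 1 ∧
          a + θ * hitSum (avoiding A v) 1 z 1 < 1 := by
        have hc := ENNReal.Tendsto.mul_const (b := hitSum (avoiding A v) 1 z 1)
          (tendsto_id (x := 𝓝 (0 : ℝ≥0∞))) (Or.inr b1.ne)
        have hc2 := hc.const_add a
        simp only [id, zero_mul, add_zero] at hc2
        have hev := (hc2.eventually (gt_mem_nhds ha1)).and
          (ge_mem_nhds (zero_lt_one : (0 : ℝ≥0∞) < 1))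
        obtain ⟨δ, hδ, hδ'⟩ := (ENNReal.nhds_zero_basis_Iic).eventually_iff.mp hev
        exact ⟨δ, hδ.ne', (hδ' (Set.mem_Iic.mpr le_rfl)).2, (hδ' (Set.mem_Iic.mpr le_rfl)).1⟩
      have hw : (1 - θ) + θ = 1 := tsub_add_cancel_of_le hθ1
      set x := (1 - θ) * ρ + θ * z with hx
      have hxz : x ≤ z := by
        calc x ≤ (1 - θ) * z + θ * z := by rw [hx]; gcongr
          _ = z := by rw [← add_mul, hw, one_mul]
      have hρx : ρ < x := by
        have hθt : θ ≠ ∞ := ne_top_of_le_ne_top ENNReal.one_ne_top hθ1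
        calc ρ = (1 - θ) * ρ + θ * ρ := by rw [← add_mul, hw, one_mul]
          _ < x := ENNReal.add_lt_add_left
            (ENNReal.mul_ne_top (ne_top_of_le_ne_top ENNReal.one_ne_top tsub_le_self) hρtop)
            (ENNReal.mul_lt_mul_right hθ0 hθt hlt)
      have hax : hitSum (avoiding A v) 1 x 1 < 1 := by
        refine (hitSum_convex _ _ _ _ _ hw _ _).trans_lt (lt_of_le_of_lt ?_ hθ)
        gcongr
        exact mul_le_of_le_one_left zero_le tsub_le_self
      have hztop : z ≠ ∞ := by
        rintro rfl
        refine bg (top_le_iff.mp (le_trans (le_of_eq ?_) (ENNReal.le_tsum 0)))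
        rw [zero_add, pow_one, ENNReal.mul_top]
        rw [firstHit, avoiding, if_neg (Ne.symm hv1), hA, edgeWeight, if_pos (hlin.backward v)]
        exact_mod_cast (hW _ _ (hlin.backward v)).ne'
      have hxtop : x ≠ ∞ := ne_top_of_le_ne_top hztop hxz
      have hyx : hitSum A v x 1 ≠ ∞ := by
        refine ne_top_of_le_ne_top ?_ (hitSum_le_div A hv1 (fun n => ?_) hax)
        · exact ENNReal.div_ne_top (ne_top_of_le_ne_top bf (hitSum_mono _ _ _ hxz))
            (tsub_pos_of_lt hax).ne'
        · refine ENNReal.mul_ne_top (fun h => ?_) (ENNReal.pow_ne_top hxtop)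
          have h2 := ENNReal.ne_top_of_tsum_ne_top (by rw [hy, hitSum] at hytop; exact hytop) n
          rw [h, ENNReal.top_mul (pow_ne_zero _ hρ0)] at h2
          exact h2 rfl
      refine absurd (le_sSup (a := x) ?_) (not_le.mpr hρx)
      change genFun G W v x < ∞
      rw [genFun_eq, ← hA, yv]
      exact ENNReal.mul_lt_top (lt_top_iff_ne_top.mpr
        (ne_top_of_le_ne_top bg (hitSum_mono _ _ _ hxz))) hyx.lt_top
    · apply le_sSup
      change genFun G W 1 ρ < ∞
      rw [genFun_eq, ← hA, hone]
      simp
  rw [hrad, genFun_eq, ← hA]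
  refine ⟨hone, lt_top_iff_ne_top.mpr fun h => hDone ?_⟩
  rw [hA, hitDeriv_eq, h, ENNReal.mul_top hρ0]

end


/-! ### The finite subgraphs of a linear graph -/

section Comparison

variable {V : Type*}

lemma edgeWeight_mono {H G : Digraph V} (W : V → V → ℝ≥0) (h : ∀ a b, H.Adj a b → G.Adj a b)
    (i j : V) : edgeWeight H W i j ≤ edgeWeight G W i j := by
  rw [edgeWeight, edgeWeight]
  split_ifs with h1 h2
  · exact le_rfl
  · exact absurd (h _ _ h1) h2
  · exact zero_le
  · exact le_rfl

lemma firstHit_mono {A B : V → V → ℝ≥0∞} (h : ∀ i j, A i j ≤ B i j) (v : V) (n : ℕ) (i : V) :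
    firstHit A v n i ≤ firstHit B v n i := by
  induction n generalizing i with
  | zero => exact h i v
  | succ n ih =>
    rw [firstHit, firstHit]
    refine ENNReal.tsum_le_tsum fun j => ?_
    split_ifs
    · exact le_rfl
    · exact mul_le_mul' (h i j) (ih j)

lemma taboo_mono {A B : V → V → ℝ≥0∞} (h : ∀ i j, A i j ≤ B i j) (v : V) (n : ℕ) (j : V) :
    taboo A v n j ≤ taboo B v n j := by
  induction n generalizing j with
  | zero => exact le_rfl
  | succ n ih =>
    rw [taboo, taboo]
    split_ifs
    · exact le_rfl
    · exact ENNReal.tsum_le_tsum fun i => mul_le_mul' (ih i) (h i j)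

lemma firstHit_ne_top {A : V → V → ℝ≥0∞} {v : V} {z : ℝ≥0∞} (hz : z ≠ 0) {i : V}
    (h : hitSum A v z i ≠ ∞) (n : ℕ) : firstHit A v n i ≠ ∞ := by
  intro hn
  have h2 := ENNReal.ne_top_of_tsum_ne_top (by rw [hitSum] at h; exact h) n
  rw [hn, ENNReal.top_mul (pow_ne_zero _ hz)] at h2
  exact h2 rfl

lemma hitSum_ne_zero {A : V → V → ℝ≥0∞} {v : V} {z : ℝ≥0∞} (hz : z ≠ 0) {i : V}
    (h : A i v ≠ 0) : hitSum A v z i ≠ 0 := by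
  intro h0
  rw [hitSum, ENNReal.tsum_eq_zero] at h0
  simpa [firstHit, h, hz] using h0 0

/-- Power series with coefficients increasing to those of a limit series, evaluated at points
that approach their limit fast enough in comparison with the degrees. -/
lemma tendsto_tsum_mul_pow {a : ℕ → ℕ → ℝ≥0∞} {b : ℕ → ℝ≥0∞} {r : ℕ → ℝ≥0∞} {R : ℝ≥0∞}
    {e : ℕ → ℕ} {L : ℕ → ℕ} (hR0 : R ≠ 0) (hRtop : R ≠ ∞)
    (hle : ∀ n k, a n k ≤ b k) (hev : ∀ k, ∀ᶠ n in atTop, a n k = b k)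
    (hr : ∀ᶠ n in atTop, R ≤ r n)
    (hlim : Tendsto (fun n => (r n / R) ^ L n) atTop (𝓝 1))
    (hvan : ∀ᶠ n in atTop, ∀ k, a n k ≠ 0 → e k ≤ L n) :
    Tendsto (fun n => ∑' k, a n k * r n ^ e k) atTop (𝓝 (∑' k, b k * R ^ e k)) := by
  -- All occurring degrees are at most `L n`, so replacing `r n` by `R` costs one common factor.
  have hup : ∀ᶠ n in atTop, ∑' k, a n k * r n ^ e k ≤
      (r n / R) ^ L n * ∑' k, b k * R ^ e k := by
    filter_upwards [hr, hvan] with n hrn hvn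
    rw [← ENNReal.tsum_mul_left]
    refine ENNReal.tsum_le_tsum fun k => ?_
    by_cases h0 : a n k = 0
    · rw [h0, zero_mul]
      exact zero_le
    · have h1 : 1 ≤ r n / R := by
        rw [ENNReal.le_div_iff_mul_le (Or.inl hR0) (Or.inl hRtop), one_mul]
        exact hrn
      calc a n k * r n ^ e k ≤ b k * ((r n / R) ^ e k * R ^ e k) := by
            rw [← mul_pow, ENNReal.div_mul_cancel hR0 hRtop]
            gcongr
            exact hle n k
        _ ≤ b k * ((r n / R) ^ L n * R ^ e k) := by
            gcongr
            exact hvn k h0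
        _ = _ := by ring
  have hupl : Tendsto (fun n => (r n / R) ^ L n * ∑' k, b k * R ^ e k) atTop
      (𝓝 (∑' k, b k * R ^ e k)) := by
    have := ENNReal.Tendsto.mul_const (b := ∑' k, b k * R ^ e k) hlim (Or.inl one_ne_zero)
    rwa [one_mul] at this
  refine tendsto_order.mpr ⟨fun c hc => ?_, fun c hc => ?_⟩
  · obtain ⟨s, hs⟩ := ((tendsto_order.mp
      (ENNReal.summable (f := fun k => b k * R ^ e k)).hasSum).1 c hc).exists
    filter_upwards [hr, (Filter.eventually_all_finset s).mpr fun k _ => hev k] with n hrn hn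
    refine hs.trans_le (le_trans ?_ (ENNReal.sum_le_tsum s))
    refine Finset.sum_le_sum fun k hk => ?_
    rw [hn k hk]
    gcongr
  · filter_upwards [hup, (tendsto_order.mp hupl).2 c hc] with n h1 h2
    exact h1.trans_lt h2

end Comparison

/-! ### Combinatorics of the graphs generated by short cycles -/

section Linear

variable {G : Digraph ℕ+} {W : ℕ+ → ℕ+ → ℝ≥0}

lemma cycleSubgraph_le {n : ℕ} {a b : ℕ+} (h : (cycleSubgraph G 1 n).Adj a b) : G.Adj a b := by
  obtain ⟨l, -, x, hx, i, rfl, rfl⟩ := h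
  exact hx.2.2.2.1 i

lemma cycleSubgraph_mono {m n : ℕ} (hmn : m ≤ n) {a b : ℕ+}
    (h : (cycleSubgraph G 1 m).Adj a b) : (cycleSubgraph G 1 n).Adj a b := by
  obtain ⟨l, hl, x⟩ := h
  exact ⟨l, hl.trans hmn, x⟩

lemma simpleCycles_cycleSubgraph {l n : ℕ} (h : l ≤ n) :
    simpleCycles (cycleSubgraph G 1 n) 1 l = simpleCycles G 1 l := by
  ext x
  constructor
  · rintro ⟨h1, h2, h3, h4, h5⟩
    exact ⟨h1, h2, h3, fun i => cycleSubgraph_le (h4 i), h5⟩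
  · intro hx
    exact ⟨hx.1, hx.2.1, hx.2.2.1, fun i => ⟨l, h, x, hx, i, rfl, rfl⟩, hx.2.2.2.2⟩

lemma firstHit_cycleSubgraph {k n : ℕ} (h : k < n) :
    firstHit (edgeWeight (cycleSubgraph G 1 n) W) 1 k 1 = firstHit (edgeWeight G W) 1 k 1 := by
  rw [← cycleSum_succ, ← cycleSum_succ, cycleSum, cycleSum, simpleCycles_cycleSubgraph h]

/-- A path that starts at `1` and does not return there can be closed to a simple cycle. -/
lemma cycleSubgraph_adj_of_path {x : ℕ → ℕ+} {m n : ℕ} (hmn : m < n) (h0 : x 0 = 1)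
    (hadj : ∀ i < m, G.Adj (x i) (x (i + 1))) (hne : ∀ i, 1 ≤ i → i ≤ m → x i ≠ 1)
    (hlast : G.Adj (x m) 1) :
    (∀ i < m, (cycleSubgraph G 1 n).Adj (x i) (x (i + 1))) ∧
      (cycleSubgraph G 1 n).Adj (x m) 1 := by
  let y : Fin (m + 1 + 1) → ℕ+ := fun j => if (j : ℕ) ≤ m then x j else 1
  have hy : y ∈ simpleCycles G 1 (m + 1) := by
    refine ⟨by omega, ?_, ?_, ?_, ?_⟩
    · simp [y, h0]
    · simp [y]
    · intro i
      have hi : (i : ℕ) ≤ m := by omega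
      simp only [y, Fin.val_castSucc, hi, if_true, Fin.val_succ]
      split_ifs with h
      · exact hadj i (by omega)
      · have : (i : ℕ) = m := by omega
        rw [this]
        exact hlast
    · intro i hi hi'
      have h1 : (i : ℕ) ≠ 0 := fun h => hi (Fin.ext h)
      have h2 : (i : ℕ) ≠ m + 1 := fun h => hi' (Fin.ext h)
      have h3 : (i : ℕ) ≤ m := by omega
      simp only [y, if_pos h3]
      exact hne i (by omega) h3
  constructor
  · intro i hi
    refine ⟨m + 1, hmn, y, hy, ⟨i, by omega⟩, ?_, ?_⟩
    · simp [y, hi.le]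
    · simp [y, Nat.succ_le_of_lt hi]
  · refine ⟨m + 1, hmn, y, hy, Fin.last m, ?_, ?_⟩
    · simp [y]
    · simp [y]

/-- A generating cycle can be cut short at `a` and closed by the edge `(a, 1)` without becoming
longer. -/
lemma cycleSubgraph_adj_one (hlin : IsLinear G) {n : ℕ} {a b : ℕ+}
    (h : (cycleSubgraph G 1 n).Adj a b) : (cycleSubgraph G 1 n).Adj a 1 := by
  obtain ⟨l, hl, x, hx, i, rfl, rfl⟩ := h
  let y : ℕ → ℕ+ := fun j => x ⟨min j i, by omega⟩
  have hy := (cycleSubgraph_adj_of_path (G := G) (x := y) (m := i) (n := n) (by omega)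
    (by simpa [y] using hx.2.1) (fun j hj => ?_) (fun j hj hj' => ?_) (hlin.backward _)).2
  · have e1 : y i = x i.castSucc := by simp only [y, min_self]; rfl
    rwa [e1] at hy
  · have h1 := hx.2.2.2.1 ⟨j, by omega⟩
    have e1 : min j (i : ℕ) = j := by omega
    have e2 : min (j + 1) (i : ℕ) = j + 1 := by omega
    simp only [y, e1, e2]
    exact h1
  · have e1 : min j (i : ℕ) = j := by omega
    simp only [y, e1]
    refine hx.2.2.2.2 _ ?_ ?_
    · intro h
      have := congrArg Fin.val h
      simp at this
      omega
    · intro h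
      have := congrArg Fin.val h
      simp at this
      omega

/-- The edge lies on the simple cycle 1, 2, …, a, b, 1 of length `a + 1`, or on 1, 2, …, a, 1 if `b
= 1`. -/
lemma cycleSubgraph_exhausts (hlin : IsLinear G) {a b : ℕ+} (h : G.Adj a b) {n : ℕ}
    (hn : (a : ℕ) < n) : (cycleSubgraph G 1 n).Adj a b := by
  by_cases hb : b = 1
  · subst hb
    have := (cycleSubgraph_adj_of_path (G := G) (x := Nat.succPNat) (m := a - 1) (n := n)
      (by omega) rfl (fun i _ => hlin.step _) (fun i hi _ h1 => ?_) (hlin.backward _)).2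
    · rwa [show Nat.succPNat (a - 1) = a from PNat.succPNat_natPred a] at this
    · have := congrArg PNat.val h1
      simp at this
      omega
  · let y : ℕ → ℕ+ := fun j => if j < a then Nat.succPNat j else b
    have ha := a.pos
    have e1 : y (a - 1) = a := by
      simp only [y, if_pos (show (a : ℕ) - 1 < a by omega)]
      exact PNat.succPNat_natPred a
    have e2 : y a = b := by simp [y]
    have := (cycleSubgraph_adj_of_path (G := G) (x := y) (m := a) (n := n) hn
      (by simp [y]; rfl) (fun i hi => ?_) (fun i hi hi' => ?_) (hlin.backward _)).1 (a - 1) (by omega)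
    · rwa [show (a : ℕ) - 1 + 1 = a by omega, e1, e2] at this
    · by_cases hi2 : i + 1 < a
      · simp only [y, if_pos hi, if_pos hi2]
        exact hlin.step _
      · have e3 : i = a - 1 := by omega
        rw [e3, show (a : ℕ) - 1 + 1 = a by omega, e1, e2]
        exact h
    · simp only [y]
      split_ifs
      · intro h1
        have := congrArg PNat.val h1
        simp at this
        omega
      · exact hb

variable {K : ℕ}

/-- After `j` steps from 1 a generating cycle has reached at most `K * j + 1`. -/
lemma le_of_cycleSubgraph_adj (hlin : IsLinear G)
    (hK : ∀ i j : ℕ+, G.Adj i j → i < j → (j : ℕ) - (i : ℕ) < K) {n : ℕ} {a b : ℕ+}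
    (h : (cycleSubgraph G 1 n).Adj a b) : (a : ℕ) ≤ K * n + 1 := by
  obtain ⟨l, hl, x, hx, i, rfl, rfl⟩ := h
  have key : ∀ j (hj : j < l), (x ⟨j, by omega⟩ : ℕ) ≤ K * j + 1 := by
    intro j
    induction j with
    | zero =>
      intro hj
      have : x ⟨0, by omega⟩ = 1 := hx.2.1
      rw [this]
      simp
    | succ j ih =>
      intro hj
      have h1 := hx.2.2.2.1 ⟨j, by omega⟩
      have h2 : x ⟨j + 1, by omega⟩ ≠ 1 := by
        refine hx.2.2.2.2 _ ?_ ?_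
        · exact fun h => by simpa using congrArg Fin.val h
        · intro h
          have := congrArg Fin.val h
          simp at this
          omega
      have h3 : x ⟨j, by omega⟩ < x ⟨j + 1, by omega⟩ := hlin.lt_of_adj h1 h2
      have h4 := hK _ _ h1 h3
      have h5 := ih (by omega)
      have h6 : (x ⟨j, by omega⟩ : ℕ) < (x ⟨j + 1, by omega⟩ : ℕ) := h3
      have h7 : (x ⟨j + 1, by omega⟩ : ℕ) - (x ⟨j, by omega⟩ : ℕ) < K := h4
      rw [Nat.mul_succ]
      omega
  have h1 := key i i.2
  have h2 : K * (i : ℕ) ≤ K * n := Nat.mul_le_mul_left K (by omega)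
  have h3 : x i.castSucc = x ⟨i, by omega⟩ := rfl
  rw [h3]
  omega

lemma adj_le_add (hlin : IsLinear G)
    (hK : ∀ i j : ℕ+, G.Adj i j → i < j → (j : ℕ) - (i : ℕ) < K) {a b : ℕ+} (h : G.Adj a b) :
    (b : ℕ) ≤ a + K := by
  by_cases hb : b = 1
  · subst hb
    have := a.pos
    simp
    omega
  · have := hK a b h (hlin.lt_of_adj h hb)
    omega

lemma exists_outNeighbors (hlin : IsLinear G)
    (hK : ∀ i j : ℕ+, G.Adj i j → i < j → (j : ℕ) - (i : ℕ) < K) (i : ℕ+) :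
    ∃ F : Finset ℕ+, F.card ≤ K + 2 ∧ ∀ j, G.Adj i j → j ∈ F := by
  refine ⟨insert 1 ((Finset.range (K + 1)).image fun t => (⟨i + t, by positivity⟩ : ℕ+)), ?_, ?_⟩
  · refine (Finset.card_insert_le _ _).trans ?_
    exact Nat.succ_le_succ (Finset.card_image_le.trans_eq (Finset.card_range _))
  · intro j hj
    by_cases h1 : j = 1
    · simp [h1]
    · have h2 : (i : ℕ) < j := hlin.lt_of_adj hj h1
      have h3 := adj_le_add hlin hK hj
      refine Finset.mem_insert_of_mem (Finset.mem_image.mpr ⟨j - i, ?_, ?_⟩)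
      · rw [Finset.mem_range]
        omega
      · apply PNat.eq
        simp
        omega

lemma finite_edges_cycleSubgraph (hlin : IsLinear G)
    (hK : ∀ i j : ℕ+, G.Adj i j → i < j → (j : ℕ) - (i : ℕ) < K) (n : ℕ) :
    {e : ℕ+ × ℕ+ | (cycleSubgraph G 1 n).Adj e.1 e.2}.Finite := by
  have hfin : (Set.Iic (Nat.succPNat (K * n + 1 + K))).Finite := Set.finite_Iic _
  refine (hfin.prod hfin).subset fun e he => ?_
  have h1 := le_of_cycleSubgraph_adj hlin hK he
  have h2 := adj_le_add hlin hK (cycleSubgraph_le he)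
  constructor
  · change (e.1 : ℕ) ≤ K * n + 1 + K + 1
    omega
  · change (e.2 : ℕ) ≤ K * n + 1 + K + 1
    omega

lemma isExhaustive_cycleSubgraph (hlin : IsLinear G) :
    IsExhaustive G fun k => cycleSubgraph G 1 (k + 1) := by
  refine ⟨fun k a b h => cycleSubgraph_le h, fun k a b h => cycleSubgraph_mono (by omega) h,
    fun a b h => ⟨a, cycleSubgraph_exhausts hlin h (by omega)⟩, fun a => ⟨a, 1, Or.inl ?_⟩⟩
  exact cycleSubgraph_exhausts hlin (hlin.backward a) (by omega)

/-- A path off 1 ascends at each step, so after `k` steps it is at `i + k` or beyond, at the start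
of an edge of `H`. This bounds cycle lengths by the largest vertex. -/
lemma le_of_firstHit_ne_zero {H : Digraph ℕ+} (hlin : IsLinear G)
    (hH : ∀ a b, H.Adj a b → G.Adj a b) {M : ℕ} (hM : ∀ a b, H.Adj a b → (a : ℕ) ≤ M) {k : ℕ}
    {i : ℕ+} (h : firstHit (edgeWeight H W) 1 k i ≠ 0) : (i : ℕ) + k ≤ M := by
  have hadj : ∀ i j, edgeWeight H W i j ≠ 0 → H.Adj i j := by
    intro i j h
    by_contra hcon
    exact h (by rw [edgeWeight, if_neg hcon])
  induction k generalizing i with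
  | zero => exact hM _ _ (hadj _ _ h)
  | succ k ih =>
    rw [firstHit, Ne, ENNReal.tsum_eq_zero, not_forall] at h
    obtain ⟨j, hj⟩ := h
    split_ifs at hj with hj1
    · exact absurd rfl hj
    · have h1 := ih (right_ne_zero_of_mul hj)
      have h2 : (i : ℕ) < j := hlin.lt_of_adj (hH _ _ (hadj _ _ (left_ne_zero_of_mul hj))) hj1
      omega

lemma lt_of_taboo_ne_zero (hlin : IsLinear G) {k : ℕ} {j : ℕ+}
    (h : taboo (edgeWeight G W) 1 k j ≠ 0) : k < j := by
  induction k generalizing j with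
  | zero => exact j.pos
  | succ k ih =>
    rw [taboo] at h
    split_ifs at h with hj1
    · exact absurd rfl h
    · rw [Ne, ENNReal.tsum_eq_zero, not_forall] at h
      obtain ⟨i, hi⟩ := h
      have h1 := ih (left_ne_zero_of_mul hi)
      have h2 : G.Adj i j := by
        by_contra hcon
        exact right_ne_zero_of_mul hi (by rw [edgeWeight, if_neg hcon])
      have h3 : (i : ℕ) < j := hlin.lt_of_adj h2 hj1
      omega

lemma eventually_edgeWeight_eq (hlin : IsLinear G) (i j : ℕ+) :
    ∀ᶠ n in atTop, edgeWeight (cycleSubgraph G 1 n) W i j = edgeWeight G W i j := by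
  filter_upwards [eventually_gt_atTop (i : ℕ)] with n hn
  have : (cycleSubgraph G 1 n).Adj i j ↔ G.Adj i j :=
    ⟨cycleSubgraph_le, fun h => cycleSubgraph_exhausts hlin h hn⟩
  rw [edgeWeight, edgeWeight, this]

/-- Only finitely many edges leave each vertex, and each of them eventually belongs to the subgraph.
-/
lemma eventually_firstHit_eq (hlin : IsLinear G)
    (hK : ∀ i j : ℕ+, G.Adj i j → i < j → (j : ℕ) - (i : ℕ) < K) (k : ℕ) (i : ℕ+) :
    ∀ᶠ n in atTop, firstHit (edgeWeight (cycleSubgraph G 1 n) W) 1 k i =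
      firstHit (edgeWeight G W) 1 k i := by
  induction k generalizing i with
  | zero => exact eventually_edgeWeight_eq hlin i 1
  | succ k ih =>
    obtain ⟨F, -, hF⟩ := exists_outNeighbors hlin hK i
    filter_upwards [(Filter.eventually_all_finset F).mpr fun j _ => ih j,
      (Filter.eventually_all_finset F).mpr fun j _ => eventually_edgeWeight_eq (W := W) hlin i j]
      with n h1 h2
    rw [firstHit, firstHit]
    refine tsum_congr fun j => ?_
    by_cases hj : j ∈ F
    · rw [h1 j hj, h2 j hj]
    · have h3 : ¬ G.Adj i j := fun h => hj (hF j h)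
      have h4 : ¬ (cycleSubgraph G 1 n).Adj i j := fun h => h3 (cycleSubgraph_le h)
      rw [edgeWeight, edgeWeight, if_neg h3, if_neg h4]
      simp

/-- Vertices other than 1 have only smaller predecessors, hence finitely many. -/
lemma eventually_taboo_eq (hlin : IsLinear G) (k : ℕ) (j : ℕ+) :
    ∀ᶠ n in atTop, taboo (edgeWeight (cycleSubgraph G 1 n) W) 1 k j =
      taboo (edgeWeight G W) 1 k j := by
  induction k generalizing j with
  | zero => exact Eventually.of_forall fun n => rfl
  | succ k ih =>
    filter_upwards [(Filter.eventually_all_finset (Finset.Iio j)).mpr fun i _ => ih i,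
      (Filter.eventually_all_finset (Finset.Iio j)).mpr fun i _ =>
        eventually_edgeWeight_eq (W := W) hlin i j] with n h1 h2
    rw [taboo, taboo]
    split_ifs with hj
    · rfl
    · refine tsum_congr fun i => ?_
      by_cases hi : i ∈ Finset.Iio j
      · rw [h1 i hi, h2 i hi]
      · have h3 : ¬ G.Adj i j := fun h => hi (Finset.mem_Iio.mpr (hlin.lt_of_adj h hj))
        have h4 : ¬ (cycleSubgraph G 1 n).Adj i j := fun h => h3 (cycleSubgraph_le h)
        rw [edgeWeight, edgeWeight, if_neg h3, if_neg h4, mul_zero, mul_zero]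

end Linear


/-! ### Convergence of the finite approximations -/

/-- The series is a polynomial vanishing at 0. Its linear term makes it strictly increasing and
already reaches 1 at the inverse of `q 0`. -/
lemma existsUnique_tsum_mul_pow_eq_one {q : ℕ → ℝ≥0∞} (hq : ∀ k, q k ≠ ∞) {M : ℕ}
    (hM : ∀ k, M ≤ k → q k = 0) (h0 : q 0 ≠ 0) :
    ∃! r : ℝ≥0, ∑' k, q k * (r : ℝ≥0∞) ^ (k + 1) = 1 := by
  let f : ℝ≥0 → ℝ≥0 := fun r => ∑ k ∈ Finset.range M, (q k).toNNReal * r ^ (k + 1)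
  have hf : ∀ r : ℝ≥0, ∑' k, q k * (r : ℝ≥0∞) ^ (k + 1) = (f r : ℝ≥0∞) := by
    intro r
    rw [tsum_eq_sum (s := Finset.range M)]
    · simp only [f, ENNReal.ofNNReal_finsetSum, ENNReal.coe_mul, ENNReal.coe_pow,
        ENNReal.coe_toNNReal (hq _)]
    · intro k hk
      rw [hM k (by simpa using hk), zero_mul]
  have hM0 : 0 ∈ Finset.range M := by
    rw [Finset.mem_range]
    by_contra hcon
    exact h0 (hM 0 (not_lt.mp hcon))
  have hc0 : 0 < (q 0).toNNReal := ENNReal.toNNReal_pos h0 (hq 0)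
  have hmono : StrictMono f := by
    intro x y hxy
    refine Finset.sum_lt_sum (fun k _ => by gcongr) ⟨0, hM0, ?_⟩
    simpa using mul_lt_mul_of_pos_left hxy hc0
  have hcont : Continuous f := by fun_prop
  have hf0 : f 0 = 0 := by simp [f]
  have hf1 : 1 ≤ f ((q 0).toNNReal)⁻¹ := by
    have := Finset.single_le_sum
      (f := fun k => (q k).toNNReal * ((q 0).toNNReal)⁻¹ ^ (k + 1)) (fun k _ => zero_le) hM0
    rw [zero_add, pow_one, mul_inv_cancel₀ hc0.ne'] at this
    exact this
  obtain ⟨r, -, hr⟩ := intermediate_value_Icc (zero_le : 0 ≤ ((q 0).toNNReal)⁻¹)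
    hcont.continuousOn (show (1 : ℝ≥0) ∈ Set.Icc (f 0) (f ((q 0).toNNReal)⁻¹) from
      ⟨by rw [hf0]; exact zero_le, hf1⟩)
  refine ⟨r, ?_, fun s hs => ?_⟩
  · change ∑' k, q k * (r : ℝ≥0∞) ^ (k + 1) = 1
    rw [hf, hr, ENNReal.coe_one]
  · change ∑' k, q k * (s : ℝ≥0∞) ^ (k + 1) = 1 at hs
    rw [hf, ENNReal.coe_eq_one] at hs
    exact hmono.injective (hs.trans hr.symm)

lemma hitSum_eq_head_add {V : Type*} (A : V → V → ℝ≥0∞) (v : V) (z : ℝ≥0∞) (i : V) :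
    hitSum A v z i = A i v * z + ∑' k : ℕ, firstHit A v (k + 1) i * z ^ (k + 2) := by
  rw [hitSum, tsum_eq_zero_add' ENNReal.summable]
  simp [firstHit]

/-- If the return series at `R` of a graph is `1` and that of a graph with smaller weights, but the
same returns of length at most `n`, is `1` at `r`, then `r - R` is bounded by the tail of the
return series. -/
lemma mul_root_le {V : Type*} {A B : V → V → ℝ≥0∞} {v : V} {R r : ℝ≥0∞} {n : ℕ}
    (hBA : ∀ i j, B i j ≤ A i j) (hvv : B v v = A v v) (hv0 : A v v ≠ 0) (hvtop : A v v ≠ ∞)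
    (hR : hitSum A v R v = 1) (hr : hitSum B v r v = 1)
    (heq : ∀ k < n, firstHit B v k v = firstHit A v k v) :
    R ≤ r ∧ A v v * r ≤ A v v * R + ∑' k, firstHit A v (k + n) v * R ^ (k + n + 1) := by
  obtain ⟨hR0, hRtop⟩ := ne_zero_and_ne_top_of_hitSum_eq_one hR
  have hle : hitSum B v R v ≤ 1 := by
    rw [← hR]
    exact ENNReal.tsum_le_tsum fun k => mul_le_mul' (firstHit_mono hBA v k v) le_rfl
  have hrest : ∀ x y : ℝ≥0∞, x ≤ y →
      ∑' k : ℕ, firstHit B v (k + 1) v * x ^ (k + 2) ≤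
        ∑' k : ℕ, firstHit B v (k + 1) v * y ^ (k + 2) := fun x y h =>
    ENNReal.tsum_le_tsum fun k => by gcongr
  have hRr : R ≤ r := by
    by_contra hlt
    push Not at hlt
    have h1 : A v v * r < A v v * R := ENNReal.mul_lt_mul_right hv0 hvtop hlt
    have h2 := hr
    rw [hitSum_eq_head_add, hvv] at h2 hle
    have h3 : (∑' k : ℕ, firstHit B v (k + 1) v * r ^ (k + 2)) ≠ ∞ :=
      ne_top_of_le_ne_top ENNReal.one_ne_top (h2 ▸ le_add_self)
    have h4 := ENNReal.add_lt_add_of_lt_of_le h3 h1 (hrest r R hlt.le)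
    rw [h2] at h4
    exact absurd hle (not_le.mpr h4)
  refine ⟨hRr, ?_⟩
  set T := ∑' k, firstHit A v (k + n) v * R ^ (k + n + 1)
  have h1 : 1 ≤ hitSum B v R v + T := by
    rw [← hR, hitSum, ← ENNReal.summable.sum_add_tsum_nat_add' (k := n)]
    gcongr
    rw [Finset.sum_congr rfl fun k hk => by rw [← heq k (Finset.mem_range.mp hk)]]
    exact ENNReal.sum_le_tsum _
  -- Only the linear term is evaluated at both points; the higher terms at `R` are bounded by those
  -- at `r`, where the whole series is 1.
  have h2 : A v v * r + hitSum B v R v ≤ A v v * R + T + hitSum B v R v := by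
    calc A v v * r + hitSum B v R v =
          A v v * r + (∑' k : ℕ, firstHit B v (k + 1) v * R ^ (k + 2)) + A v v * R := by
          rw [hitSum_eq_head_add, hvv]
          ring
      _ ≤ 1 + A v v * R := by
          rw [← hr, hitSum_eq_head_add B v r, hvv]
          gcongr
      _ ≤ hitSum B v R v + T + A v v * R := by gcongr
      _ = _ := by ring
  exact (ENNReal.add_le_add_iff_right (ne_top_of_le_ne_top ENNReal.one_ne_top hle)).mp h2

/-- With `x = E n / (c * R)`, the ratio is at most `1 + x / n ≤ exp (x / n)`, so its power is at
most `exp ((K + 2) * x)`, and `x` tends to 0. -/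
lemma tendsto_pow_of_mul_le {r T E : ℕ → ℝ≥0∞} {R c : ℝ≥0∞} (hR0 : R ≠ 0) (hRtop : R ≠ ∞)
    (hc0 : c ≠ 0) (hctop : c ≠ ∞) (K : ℕ)
    (h : ∀ n, 1 ≤ n → R ≤ r n ∧ c * r n ≤ c * R + T n) (hT : ∀ n, n * T n ≤ E n)
    (hE : Tendsto E atTop (𝓝 0)) :
    Tendsto (fun n => (r n / R) ^ (K * n + 2)) atTop (𝓝 1) := by
  have hw0 : c * R ≠ 0 := mul_ne_zero hc0 hR0
  have hwtop : c * R ≠ ∞ := ENNReal.mul_ne_top hctop hRtop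
  have hx : Tendsto (fun n => (E n / (c * R)).toReal) atTop (𝓝 0) := by
    have h1 : Tendsto (fun n => E n / (c * R)) atTop (𝓝 0) := by
      have := ENNReal.Tendsto.div_const hE (Or.inr hw0)
      rwa [ENNReal.zero_div] at this
    have h2 := (ENNReal.tendsto_toReal ENNReal.zero_ne_top).comp h1
    rwa [ENNReal.toReal_zero] at h2
  have hup : Tendsto (fun n => ENNReal.ofReal (Real.exp ((K + 2) * (E n / (c * R)).toReal)))
      atTop (𝓝 1) := by
    have h1 : Tendsto (fun n => Real.exp ((K + 2) * (E n / (c * R)).toReal)) atTop (𝓝 1) := by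
      have h2 := (Real.continuous_exp.tendsto _).comp (hx.const_mul ((K : ℝ) + 2))
      rw [mul_zero, Real.exp_zero] at h2
      exact h2
    simpa using ENNReal.tendsto_ofReal h1
  refine tendsto_of_tendsto_of_tendsto_of_le_of_le' tendsto_const_nhds hup ?_ ?_
  · filter_upwards [eventually_ge_atTop 1] with n hn
    refine one_le_pow₀ ?_
    rw [ENNReal.le_div_iff_mul_le (Or.inl hR0) (Or.inl hRtop), one_mul]
    exact (h n hn).1
  · filter_upwards [eventually_ge_atTop 1,
      (tendsto_order.mp hE).2 ∞ ENNReal.zero_lt_top] with n hn hEn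
    set x := (E n / (c * R)).toReal with hxdef
    have hx0 : 0 ≤ x := ENNReal.toReal_nonneg
    have hn0 : (0 : ℝ) < n := by exact_mod_cast hn
    have hn1 : (1 : ℝ) ≤ n := by exact_mod_cast hn
    have hTn : T n / (c * R) ≤ ENNReal.ofReal (x / n) := by
      rw [ENNReal.ofReal_div_of_pos hn0, hxdef, ENNReal.ofReal_toReal
        (ENNReal.div_ne_top hEn.ne hw0), ENNReal.ofReal_natCast,
        ENNReal.le_div_iff_mul_le (Or.inl (by exact_mod_cast (by omega : n ≠ 0)))
          (Or.inl (ENNReal.natCast_ne_top n)), mul_comm, ← mul_div_assoc]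
      exact ENNReal.div_le_div_right (hT n) _
    have h1 : r n / R ≤ ENNReal.ofReal (Real.exp (x / n)) := by
      calc r n / R = c * r n / (c * R) := (ENNReal.mul_div_mul_left _ _ hc0 hctop).symm
        _ ≤ (c * R + T n) / (c * R) := ENNReal.div_le_div_right (h n hn).2 _
        _ = 1 + T n / (c * R) := by rw [ENNReal.add_div, ENNReal.div_self hw0 hwtop]
        _ ≤ 1 + ENNReal.ofReal (x / n) := by gcongr
        _ = ENNReal.ofReal (x / n + 1) := by
            rw [ENNReal.ofReal_add (by positivity) zero_le_one, ENNReal.ofReal_one, add_comm]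
        _ ≤ _ := ENNReal.ofReal_le_ofReal (Real.add_one_le_exp _)
    calc (r n / R) ^ (K * n + 2) ≤ ENNReal.ofReal (Real.exp (x / n)) ^ (K * n + 2) := by gcongr
      _ = ENNReal.ofReal (Real.exp ((K * n + 2 : ℕ) * (x / n))) := by
          rw [← ENNReal.ofReal_pow (Real.exp_pos _).le, Real.exp_nat_mul]
      _ ≤ _ := by
          refine ENNReal.ofReal_le_ofReal (Real.exp_le_exp.mpr ?_)
          push_cast
          have h2 : ((K : ℝ) * n + 2) * (x / n) = K * x + 2 * (x / n) := by field_simp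
          have h3 : x / n ≤ x := div_le_self hx0 hn1
          rw [h2]
          linarith

/-! ### Limits of roots, eigenvectors and cylinder probabilities -/

section Linear

variable {G : Digraph ℕ+} {W : ℕ+ → ℕ+ → ℝ≥0} {K : ℕ} {R : ℝ≥0∞}

/-- Harmonicity passes finiteness from `i` to `i + 1` along the edge between them, starting from the
value 1 at 1. -/
lemma hitSum_ne_top (hlin : IsLinear G) (hW : ∀ i j, G.Adj i j → 0 < W i j)
    (hR : hitSum (edgeWeight G W) 1 R 1 = 1) (i : ℕ+) :
    hitSum (edgeWeight G W) 1 R i ≠ ∞ := by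
  have hR0 := (ne_zero_and_ne_top_of_hitSum_eq_one hR).1
  induction i using PNat.recOn with
  | one => rw [hR]; exact ENNReal.one_ne_top
  | succ i ih =>
    intro h
    refine ih (top_le_iff.mp ?_)
    rw [hitSum_eq_of_eq_one _ _ _ hR i]
    refine le_trans (le_of_eq ?_) (ENNReal.le_tsum (i + 1))
    rw [h, ENNReal.mul_top]
    refine mul_ne_zero hR0 ?_
    rw [edgeWeight, if_pos (hlin.step i)]
    exact_mod_cast (hW _ _ (hlin.step i)).ne'

lemma edgeWeight_ne_zero {H : Digraph ℕ+} (hW : ∀ i j, H.Adj i j → 0 < W i j) {i j : ℕ+}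
    (h : H.Adj i j) : edgeWeight H W i j ≠ 0 := by
  rw [edgeWeight, if_pos h]
  exact_mod_cast (hW _ _ h).ne'

lemma edgeWeight_ne_top (H : Digraph ℕ+) (i j : ℕ+) : edgeWeight H W i j ≠ ∞ := by
  rw [edgeWeight]
  split_ifs
  · exact ENNReal.coe_ne_top
  · exact ENNReal.zero_ne_top

lemma firstHit_cycleSubgraph_eq_zero (hlin : IsLinear G)
    (hK : ∀ i j : ℕ+, G.Adj i j → i < j → (j : ℕ) - (i : ℕ) < K) {n k : ℕ} {i : ℕ+}
    (hk : K * n + 1 ≤ k) : firstHit (edgeWeight (cycleSubgraph G 1 n) W) 1 k i = 0 := by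
  by_contra h
  have := le_of_firstHit_ne_zero hlin (fun _ _ => cycleSubgraph_le)
    (fun _ _ => le_of_cycleSubgraph_adj hlin hK) h
  have := i.pos
  omega

lemma firstHit_cycleSubgraph_ne_top (hlin : IsLinear G) (hW : ∀ i j, G.Adj i j → 0 < W i j)
    (hR : hitSum (edgeWeight G W) 1 R 1 = 1) (n k : ℕ) (i : ℕ+) :
    firstHit (edgeWeight (cycleSubgraph G 1 n) W) 1 k i ≠ ∞ :=
  ne_top_of_le_ne_top
    (firstHit_ne_top (ne_zero_and_ne_top_of_hitSum_eq_one hR).1 (hitSum_ne_top hlin hW hR i) k)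
    (firstHit_mono (edgeWeight_mono W fun _ _ => cycleSubgraph_le) 1 k i)

lemma cycleSubgraph_adj_one_one (hlin : IsLinear G) {n : ℕ} (hn : 1 ≤ n) :
    (cycleSubgraph G 1 n).Adj 1 1 :=
  (cycleSubgraph_adj_of_path (G := G) (x := fun _ => 1) (m := 0) hn rfl (by simp)
    (by intro i hi hi'; omega) (hlin.backward 1)).2

lemma existsUnique_root (hlin : IsLinear G)
    (hK : ∀ i j : ℕ+, G.Adj i j → i < j → (j : ℕ) - (i : ℕ) < K)
    (hW : ∀ i j, G.Adj i j → 0 < W i j)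
    (hR : hitSum (edgeWeight G W) 1 R 1 = 1) {n : ℕ} (hn : 1 ≤ n) :
    ∃! r : ℝ≥0, genFun (cycleSubgraph G 1 n) W 1 r = 1 := by
  simp_rw [genFun_eq, hitSum]
  refine existsUnique_tsum_mul_pow_eq_one
    (fun k => firstHit_cycleSubgraph_ne_top hlin hW hR n k 1)
    (fun k hk => firstHit_cycleSubgraph_eq_zero hlin hK hk) ?_
  exact edgeWeight_ne_zero (fun i j h => hW i j (cycleSubgraph_le h))
    (cycleSubgraph_adj_one_one hlin hn)

/-- The roots of the return series of the finite subgraphs converge to that of the whole graph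
faster than the inverse of the longest cycles. -/
lemma tendsto_root_pow (hlin : IsLinear G) (hW : ∀ i j, G.Adj i j → 0 < W i j)
    (hR : hitSum (edgeWeight G W) 1 R 1 = 1) (hD : hitDeriv (edgeWeight G W) 1 R 1 ≠ ∞)
    {r : ℕ → ℝ≥0∞} (hr : ∀ n, 1 ≤ n → genFun (cycleSubgraph G 1 n) W 1 (r n) = 1) (K : ℕ) :
    (∀ n, 1 ≤ n → R ≤ r n) ∧ Tendsto (fun n => (r n / R) ^ (K * n + 2)) atTop (𝓝 1) := by
  obtain ⟨hR0, hRtop⟩ := ne_zero_and_ne_top_of_hitSum_eq_one hR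
  have h11 := edgeWeight_ne_zero hW (hlin.backward 1)
  have hroot : ∀ n, 1 ≤ n → R ≤ r n ∧ edgeWeight G W 1 1 * r n ≤ edgeWeight G W 1 1 * R +
      ∑' k, firstHit (edgeWeight G W) 1 (k + n) 1 * R ^ (k + n + 1) := by
    intro n hn
    have h1 := hr n hn
    rw [genFun_eq] at h1
    refine mul_root_le (edgeWeight_mono W fun _ _ => cycleSubgraph_le) ?_ h11
      (edgeWeight_ne_top G 1 1) hR h1 fun k hk => firstHit_cycleSubgraph hk
    rw [edgeWeight, edgeWeight, if_pos (hlin.backward 1),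
      if_pos (cycleSubgraph_adj_one_one hlin hn)]
  refine ⟨fun n hn => (hroot n hn).1, ?_⟩
  -- `E n` is a tail of the convergent series for `R` times Φ'(R); it dominates `n` times the tail
  -- of the return series.
  refine tendsto_pow_of_mul_le hR0 hRtop h11 (edgeWeight_ne_top G 1 1) K hroot
    (E := fun n => ∑' k, ((k + n + 1 : ℕ) : ℝ≥0∞) *
      (firstHit (edgeWeight G W) 1 (k + n) 1 * R ^ (k + n + 1))) ?_ ?_
  · intro n
    rw [← ENNReal.tsum_mul_left]
    refine ENNReal.tsum_le_tsum fun k => ?_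
    gcongr
    omega
  · exact ENNReal.tendsto_sum_nat_add (fun k => ((k + 1 : ℕ) : ℝ≥0∞) *
      (firstHit (edgeWeight G W) 1 k 1 * R ^ (k + 1))) hD

/-- Convergence of the quantities that determine the equilibrium measures. -/
lemma tendsto_of_roots (hlin : IsLinear G)
    (hK : ∀ i j : ℕ+, G.Adj i j → i < j → (j : ℕ) - (i : ℕ) < K)
    (hW : ∀ i j, G.Adj i j → 0 < W i j)
    (hR : hitSum (edgeWeight G W) 1 R 1 = 1) (hD : hitDeriv (edgeWeight G W) 1 R 1 ≠ ∞)
    {r : ℕ → ℝ≥0∞} (hr : ∀ n, 1 ≤ n → genFun (cycleSubgraph G 1 n) W 1 (r n) = 1) :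
    Tendsto r atTop (𝓝 R) ∧
    Tendsto (fun n => genFunDeriv (cycleSubgraph G 1 n) W 1 (r n)) atTop
      (𝓝 (genFunDeriv G W 1 R)) ∧
    (∀ i, Tendsto (fun n => hitSum (edgeWeight (cycleSubgraph G 1 n) W) 1 (r n) i) atTop
      (𝓝 (hitSum (edgeWeight G W) 1 R i))) ∧
    ∀ j, Tendsto (fun n => tabooSum (edgeWeight (cycleSubgraph G 1 n) W) 1 (r n) j) atTop
      (𝓝 (tabooSum (edgeWeight G W) 1 R j)) := by
  obtain ⟨hR0, hRtop⟩ := ne_zero_and_ne_top_of_hitSum_eq_one hR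
  obtain ⟨hge, hpow⟩ := tendsto_root_pow hlin hW hR hD hr K
  have hge' : ∀ᶠ n in atTop, R ≤ r n := (eventually_ge_atTop 1).mono hge
  have hmono : ∀ n i j, edgeWeight (cycleSubgraph G 1 n) W i j ≤ edgeWeight G W i j := fun n =>
    edgeWeight_mono W fun _ _ => cycleSubgraph_le
  have hK1 : 1 ≤ K := by
    have h1 := hK 1 (1 + 1) (hlin.step 1) (PNat.lt_add_right 1 1)
    omega
  refine ⟨?_, ?_, fun i => ?_, fun j => ?_⟩
  · have h1 : Tendsto (fun n => r n / R) atTop (𝓝 1) := by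
      refine tendsto_of_tendsto_of_tendsto_of_le_of_le' tendsto_const_nhds hpow ?_ ?_
      all_goals
        filter_upwards [hge'] with n hn
        have h1 : 1 ≤ r n / R := by
          rw [ENNReal.le_div_iff_mul_le (Or.inl hR0) (Or.inl hRtop), one_mul]
          exact hn
      · exact h1
      · exact le_self_pow₀ h1 (by omega)
    have h2 := ENNReal.Tendsto.mul_const (b := R) h1 (Or.inl one_ne_zero)
    simpa only [ENNReal.div_mul_cancel hR0 hRtop, one_mul] using h2
  · simp_rw [genFunDeriv_eq]
    refine tendsto_tsum_mul_pow (e := fun k => k) hR0 hRtop (fun n k => ?_) (fun k => ?_) hge'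
      hpow (Eventually.of_forall fun n k h => ?_)
    · exact mul_le_mul' le_rfl (firstHit_mono (hmono n) 1 k 1)
    · filter_upwards [eventually_firstHit_eq (W := W) hlin hK k 1] with n hn
      rw [hn]
    · by_contra hcon
      exact right_ne_zero_of_mul h (firstHit_cycleSubgraph_eq_zero hlin hK (by omega))
  · refine tendsto_tsum_mul_pow (e := fun k => k + 1) hR0 hRtop
      (fun n k => firstHit_mono (hmono n) 1 k i) (fun k => eventually_firstHit_eq hlin hK k i) hge'
      hpow (Eventually.of_forall fun n k h => ?_)
    by_contra hcon
    exact h (firstHit_cycleSubgraph_eq_zero hlin hK (by omega))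
  · refine tendsto_tsum_mul_pow (e := fun k => k) hR0 hRtop
      (fun n k => taboo_mono (hmono n) 1 k j) (fun k => eventually_taboo_eq hlin k j) hge'
      hpow ?_
    -- Paths from 1 to `j` that do not return to 1 are shorter than `j`, hence within the degree
    -- bound once `n ≥ j`.
    filter_upwards [eventually_ge_atTop (j : ℕ)] with n hn k hk
    have h1 : taboo (edgeWeight G W) 1 k j ≠ 0 := fun h0 =>
      hk (le_zero_iff.mp (h0 ▸ taboo_mono (hmono n) 1 k j))
    have h2 := lt_of_taboo_ne_zero hlin h1
    have h3 : 1 * n ≤ K * n := Nat.mul_le_mul_right n hK1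
    omega

/-- The equilibrium measure of an unstable positive linear graph. -/
lemma exists_equilibrium (hlin : IsLinear G)
    (hK : ∀ i j : ℕ+, G.Adj i j → i < j → (j : ℕ) - (i : ℕ) < K)
    (hW : ∀ i j, G.Adj i j → 0 < W i j)
    (hR : hitSum (edgeWeight G W) 1 R 1 = 1) (hD : genFunDeriv G W 1 R ≠ ∞) :
    ∃ μ : ProbabilityMeasure (ℤ → ℕ+), IsEquilibriumMeasure G W μ ∧
      (∀ ν, IsEquilibriumMeasure G W ν → ν = μ) ∧
      ∀ (n : ℕ) (w : Fin (n + 1) → ℕ+), (μ : Measure (ℤ → ℕ+)) (cylinder w) =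
        tabooSum (edgeWeight G W) 1 R (w 0) *
          (∏ i : Fin n, R * edgeWeight G W (w i.castSucc) (w i.succ)) *
          hitSum (edgeWeight G W) 1 R (w (Fin.last n)) / (R * genFunDeriv G W 1 R) := by
  obtain ⟨hR0, hRtop⟩ := ne_zero_and_ne_top_of_hitSum_eq_one hR
  exact exists_unique_equilibrium hR0 hRtop hW (by rw [genFun_eq, hR])
    (hitSum_ne_top hlin hW hR)
    (fun i j _ => hitSum_ne_zero hR0 (edgeWeight_ne_zero hW (hlin.backward i))) hD
    ⟨K + 2, exists_outNeighbors hlin hK⟩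

/-- The equilibrium measures of the finite subgraphs. -/
lemma exists_equilibrium_cycleSubgraph (hlin : IsLinear G)
    (hK : ∀ i j : ℕ+, G.Adj i j → i < j → (j : ℕ) - (i : ℕ) < K)
    (hW : ∀ i j, G.Adj i j → 0 < W i j)
    (hR : hitSum (edgeWeight G W) 1 R 1 = 1) {n : ℕ} {z : ℝ≥0∞}
    (hz : genFun (cycleSubgraph G 1 n) W 1 z = 1) :
    ∃ μ : ProbabilityMeasure (ℤ → ℕ+), IsEquilibriumMeasure (cycleSubgraph G 1 n) W μ ∧
      (∀ ν, IsEquilibriumMeasure (cycleSubgraph G 1 n) W ν → ν = μ) ∧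
      ∀ (m : ℕ) (w : Fin (m + 1) → ℕ+), (μ : Measure (ℤ → ℕ+)) (cylinder w) =
        tabooSum (edgeWeight (cycleSubgraph G 1 n) W) 1 z (w 0) *
          (∏ i : Fin m, z * edgeWeight (cycleSubgraph G 1 n) W (w i.castSucc) (w i.succ)) *
          hitSum (edgeWeight (cycleSubgraph G 1 n) W) 1 z (w (Fin.last m)) /
          (z * genFunDeriv (cycleSubgraph G 1 n) W 1 z) := by
  have hz' := hz
  rw [genFun_eq] at hz'
  obtain ⟨hz0, hztop⟩ := ne_zero_and_ne_top_of_hitSum_eq_one hz'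
  have hW' : ∀ i j, (cycleSubgraph G 1 n).Adj i j → 0 < W i j := fun i j h =>
    hW i j (cycleSubgraph_le h)
  refine exists_unique_equilibrium hz0 hztop hW' hz (fun i => ?_)
    (fun i j h => hitSum_ne_zero hz0 (edgeWeight_ne_zero hW' (cycleSubgraph_adj_one hlin h)))
    ?_ ⟨K + 2, fun i => ?_⟩
  · rw [hitSum, tsum_eq_sum (s := Finset.range (K * n + 1))]
    · exact ENNReal.sum_ne_top.mpr fun k _ => ENNReal.mul_ne_top
        (firstHit_cycleSubgraph_ne_top hlin hW hR n k i) (ENNReal.pow_ne_top hztop)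
    · intro k hk
      rw [firstHit_cycleSubgraph_eq_zero hlin hK (by simpa using hk), zero_mul]
  · rw [genFunDeriv_eq, tsum_eq_sum (s := Finset.range (K * n + 1))]
    · exact ENNReal.sum_ne_top.mpr fun k _ => ENNReal.mul_ne_top (ENNReal.mul_ne_top
        (ENNReal.natCast_ne_top _) (firstHit_cycleSubgraph_ne_top hlin hW hR n k 1))
        (ENNReal.pow_ne_top hztop)
    · intro k hk
      rw [firstHit_cycleSubgraph_eq_zero hlin hK (by simpa using hk), mul_zero, zero_mul]
  · obtain ⟨F, hF, hF'⟩ := exists_outNeighbors hlin hK i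
    exact ⟨F, hF, fun j h => hF' j (cycleSubgraph_le h)⟩

/-- Convergence of the probabilities of cylinders. -/
lemma tendsto_cylinder_formula (hlin : IsLinear G)
    (hK : ∀ i j : ℕ+, G.Adj i j → i < j → (j : ℕ) - (i : ℕ) < K)
    (hW : ∀ i j, G.Adj i j → 0 < W i j)
    (hR : hitSum (edgeWeight G W) 1 R 1 = 1) (hD : genFunDeriv G W 1 R ≠ ∞)
    {r : ℕ → ℝ≥0∞} (hr : ∀ n, 1 ≤ n → genFun (cycleSubgraph G 1 n) W 1 (r n) = 1)
    (m : ℕ) (w : Fin (m + 1) → ℕ+) :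
    Tendsto (fun n => tabooSum (edgeWeight (cycleSubgraph G 1 n) W) 1 (r n) (w 0) *
      (∏ i : Fin m, r n * edgeWeight (cycleSubgraph G 1 n) W (w i.castSucc) (w i.succ)) *
      hitSum (edgeWeight (cycleSubgraph G 1 n) W) 1 (r n) (w (Fin.last m)) /
      (r n * genFunDeriv (cycleSubgraph G 1 n) W 1 (r n))) atTop
      (𝓝 (tabooSum (edgeWeight G W) 1 R (w 0) *
        (∏ i : Fin m, R * edgeWeight G W (w i.castSucc) (w i.succ)) *
        hitSum (edgeWeight G W) 1 R (w (Fin.last m)) / (R * genFunDeriv G W 1 R))) := by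
  obtain ⟨hR0, hRtop⟩ := ne_zero_and_ne_top_of_hitSum_eq_one hR
  have hD' : hitDeriv (edgeWeight G W) 1 R 1 ≠ ∞ := by
    rw [hitDeriv_eq]
    exact ENNReal.mul_ne_top hRtop hD
  obtain ⟨tr, td, th, tl⟩ := tendsto_of_roots hlin hK hW hR hD' hr
  have hsum : ∑' j, tabooSum (edgeWeight G W) 1 R j * hitSum (edgeWeight G W) 1 R j =
      R * genFunDeriv G W 1 R := by
    rw [tsum_tabooSum_mul_hitSum, genFunDeriv_eq]
  have hltop : ∀ j, tabooSum (edgeWeight G W) 1 R j ≠ ∞ := by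
    intro j h
    refine (ENNReal.mul_ne_top hRtop hD) (top_le_iff.mp ?_)
    rw [← hsum]
    refine le_trans (le_of_eq ?_) (ENNReal.le_tsum j)
    rw [h, ENNReal.top_mul
      (hitSum_ne_zero hR0 (edgeWeight_ne_zero hW (hlin.backward j)))]
  have hhtop := hitSum_ne_top hlin hW hR
  have hZ0 : R * genFunDeriv G W 1 R ≠ 0 := by
    rw [← hsum]
    intro h
    rw [ENNReal.tsum_eq_zero] at h
    have := h 1
    rw [tabooSum_self, hR] at this
    simp at this
  have tA : ∀ i j, Tendsto (fun n => r n * edgeWeight (cycleSubgraph G 1 n) W i j) atTop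
      (𝓝 (R * edgeWeight G W i j)) := by
    intro i j
    refine ENNReal.Tendsto.mul tr (Or.inr (edgeWeight_ne_top G i j)) ?_ (Or.inr hRtop)
    exact tendsto_const_nhds.congr' ((eventually_edgeWeight_eq hlin i j).mono fun n h => h.symm)
  have hprod : ∀ s : Finset (Fin m),
      (∏ i ∈ s, R * edgeWeight G W (w i.castSucc) (w i.succ)) ≠ ∞ := fun s =>
    ENNReal.prod_ne_top fun i _ => ENNReal.mul_ne_top hRtop (edgeWeight_ne_top G _ _)
  have tP : Tendsto (fun n => ∏ i : Fin m,
      r n * edgeWeight (cycleSubgraph G 1 n) W (w i.castSucc) (w i.succ)) atTop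
      (𝓝 (∏ i : Fin m, R * edgeWeight G W (w i.castSucc) (w i.succ))) :=
    ENNReal.tendsto_finsetProd_of_ne_top _ (fun i _ => tA _ _)
      fun i _ => ENNReal.mul_ne_top hRtop (edgeWeight_ne_top G _ _)
  refine ENNReal.Tendsto.div ?_ (Or.inr hZ0) ?_ (Or.inr ?_)
  · exact ENNReal.Tendsto.mul (ENNReal.Tendsto.mul (tl _) (Or.inr (hprod _)) tP
      (Or.inr (hltop _))) (Or.inr (hhtop _)) (th _)
      (Or.inr (ENNReal.mul_ne_top (hltop _) (hprod _)))
  · exact ENNReal.Tendsto.mul tr (Or.inr hD) td (Or.inr hRtop)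
  · exact ENNReal.mul_ne_top (ENNReal.mul_ne_top (hltop _) (hprod _)) (hhtop _)

end Linear

end

end LoadedGraph

/-! ### Conclusion -/

theorem theorem2 (G : Digraph ℕ+) (hlin : LoadedGraph.IsLinear G)
    (hjumps : LoadedGraph.HasBoundedJumps G)
    (W : ℕ+ → ℕ+ → ℝ≥0) (hW : ∀ i j, G.Adj i j → 0 < W i j)
    (hup : LoadedGraph.IsUnstablePositive G W) :
    LoadedGraph.IsRegularSequence G W (fun k => LoadedGraph.cycleSubgraph G 1 (k + 1)) ∧
    (∀ n : ℕ, 1 ≤ n →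
      ∃! r : ℝ≥0, LoadedGraph.genFun (LoadedGraph.cycleSubgraph G 1 n) W 1 r = 1) ∧
    ∀ r : ℕ → ℝ≥0,
      (∀ n : ℕ, 1 ≤ n →
        LoadedGraph.genFun (LoadedGraph.cycleSubgraph G 1 n) W 1 (r n) = 1) →
      Tendsto
        (fun n => LoadedGraph.genFunDeriv (LoadedGraph.cycleSubgraph G 1 n) W 1 (r n)) atTop
        (𝓝 (LoadedGraph.genFunDeriv G W 1 (LoadedGraph.radius G W 1))) := by
  obtain ⟨K, hK⟩ := hjumps
  obtain ⟨hone, hderiv⟩ := LoadedGraph.unstable_positive_at_one hlin hW hup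
  set R := LoadedGraph.radius G W 1
  have hR := hone
  rw [LoadedGraph.genFun_eq] at hR
  have hRtop := (LoadedGraph.ne_zero_and_ne_top_of_hitSum_eq_one hR).2
  have hD : LoadedGraph.hitDeriv (LoadedGraph.edgeWeight G W) 1 R 1 ≠ ∞ := by
    rw [LoadedGraph.hitDeriv_eq]
    exact ENNReal.mul_ne_top hRtop hderiv.ne
  have hroot : ∀ n : ℕ, 1 ≤ n →
      ∃! r : ℝ≥0, LoadedGraph.genFun (LoadedGraph.cycleSubgraph G 1 n) W 1 r = 1 :=
    fun n hn => LoadedGraph.existsUnique_root hlin hK hW hR hn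
  refine ⟨?_, hroot, fun r hr =>
    (LoadedGraph.tendsto_of_roots hlin hK hW hR hD (r := fun n => (r n : ℝ≥0∞)) hr).2.1⟩
  choose! r hr _ using hroot
  obtain ⟨μ, hμ, hμuniq, hμcyl⟩ := LoadedGraph.exists_equilibrium hlin hK hW hR hderiv.ne
  choose μs hμs hμsuniq hμscyl using fun k : ℕ =>
    LoadedGraph.exists_equilibrium_cycleSubgraph hlin hK hW hR (hr (k + 1) (by omega))
  refine ⟨LoadedGraph.isExhaustive_cycleSubgraph hlin,
    fun k => LoadedGraph.finite_edges_cycleSubgraph hlin hK (k + 1), ⟨μ, hμ, hμuniq⟩,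
    fun k => ⟨μs k, hμs k, hμsuniq k⟩, fun ν νs hν hνs => ?_⟩
  refine LoadedGraph.tendsto_of_tendsto_cylinder hν.1.1 (fun k => (hνs k).1.1) fun m w => ?_
  -- Uniqueness identifies the given equilibrium measures with the constructed ones, whose cylinder
  -- probabilities are explicit.
  obtain rfl : νs = μs := funext fun k => hμsuniq k _ (hνs k)
  rw [hμuniq ν hν, hμcyl m w]
  simp_rw [hμscyl]
  exact (LoadedGraph.tendsto_cylinder_formula hlin hK hW hR hderiv.ne
    (r := fun n => (r n : ℝ≥0∞)) hr m w).comp (tendsto_add_atTop_nat 1)
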